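/- Let $L>0$, $\omega_0>0$, $\alpha\ge 0$, $v\in\mathbb R$, put $\omega_1=\omega_0L$, and let $f\in C^2(\mathbb R)$. Let $X,V\in C^4(\mathbb R)$ be $L$-periodic with $X>0$ everywhere, $\int_0^L X(u)\,du=L$ and $\int_0^L V(u)\,du=0$, and set $$\phi(z)=\int_0^z X(u)\,du,\qquad \psi(z)=v+\int_0^z V(u)\,du .$$ For $t\ge 0$ and $z\in\mathbb R$ write $s(t,z,\xi)=\sqrt{t^2-(z-\xi)^2/\omega_1^2}$ (for $|z-\xi|\le\omega_1t$) and $$\begin{aligned} G(t,z)={}&\frac{e^{-\frac{\alpha}{2}t}}{2}\bigl(\phi(z+\omega_1t)+\phi(z-\omega_1t)\bigr)\\ &+\frac{\alpha e^{-\frac{\alpha}{2}t}}{4\omega_1}\int_{z-\omega_1t}^{z+\omega_1t}\Bigl(t\,\frac{I_1\bigl(\frac{\alpha}{2}s(t,z,\xi)\bigr)}{s(t,z,\xi)}+I_0\bigl(\tfrac{\alpha}{2}s(t,z,\xi)\bigr)\Bigr)\phi(\xi)\,d\xi\\ &+\frac{e^{-\frac{\alpha}{2}t}}{2\omega_1}\int_{z-\omega_1t}^{z+\omega_1t}I_0\bigl(\tfrac{\alpha}{2}s(t,z,\xi)\bigr)\psi(\xi)\,d\xi\\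 &+\frac{1}{2\omega_1}\int_0^t e^{-\frac{\alpha}{2}(t-\tau)}f(\tau)\int_{z-\omega_1(t-\tau)}^{z+\omega_1(t-\tau)}I_0\bigl(\tfrac{\alpha}{2}s(t-\tau,z,\xi)\bigr)\,d\xi\,d\tau , \end{aligned}$$ where $$I_0(x)=\sum_{m=0}^\infty\frac{1}{m!\,\Gamma(m+1)}\Bigl(\frac x2\Bigr)^{2m},\qquad I_1(x)=\sum_{m=0}^\infty\frac{1}{m!\,\Gamma(m+2)}\Bigl(\frac x2\Bigr)^{2m+1}$$ are the modified Bessel functions. 1) $G$ is the unique classical solution (of class $C^2$ for $t>0$ and of class $C^1$ up to $t=0$) on $[0,\infty)\times\mathbb R$ of the Cauchy problem $$G_{tt}(t,z)=\omega_1^2G_{zz}(t,z)-\alpha G_t(t,z)+f(t)\quad(t>0,\ z\in\mathbb R),\qquad G(0,z)=\phi(z),\quad G_t(0,z)=\psi(z).$$ 2) For every fixed $t\ge 0$, if $G_z(t,z)>0$ for all $z\in\mathbb R$, then $z\mapsto G(t,z)$ is a diffeomorphism of $\mathbb R$ onto $\mathbb R$ (of class $C^5$, the regularity of $\phi$ and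 $\psi$). -/

import Mathlib

open scoped Manifold

/-- The modified Bessel function `I₀`. -/
noncomputable def besselI0 (x : ℝ) : ℝ :=
  ∑' m : ℕ, 1 / ((m.factorial : ℝ) * Real.Gamma ((m : ℝ) + 1)) * (x / 2) ^ (2 * m)

/-- The modified Bessel function `I₁`. -/
noncomputable def besselI1 (x : ℝ) : ℝ :=
  ∑' m : ℕ, 1 / ((m.factorial : ℝ) * Real.Gamma ((m : ℝ) + 2)) * (x / 2) ^ (2 * m + 1)

/-- `√(t² - (z - ξ)² / ω²)`. -/
noncomputable def coneRoot (ω t z ξ : ℝ) : ℝ :=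
  Real.sqrt (t ^ 2 - (z - ξ) ^ 2 / ω ^ 2)

/-- The explicit formula for the solution of the damped inhomogeneous wave equation with wave
speed `ω`, damping `α`, force `f`, initial position `φ` and initial velocity `ψ`.
The quotient by `coneRoot` is undefined only at the two end points of the integration interval. -/
noncomputable def explicitG (ω α : ℝ) (f φ ψ : ℝ → ℝ) (t z : ℝ) : ℝ :=
  Real.exp (-(α / 2) * t) / 2 * (φ (z + ω * t) + φ (z - ω * t))
  + α * Real.exp (-(α / 2) * t) / (4 * ω) *
      (∫ ξ in (z - ω * t)..(z + ω * t),
        (t * (besselI1 (α / 2 * coneRoot ω t z ξ) / coneRoot ω t z ξ)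
          + besselI0 (α / 2 * coneRoot ω t z ξ)) * φ ξ)
  + Real.exp (-(α / 2) * t) / (2 * ω) *
      (∫ ξ in (z - ω * t)..(z + ω * t), besselI0 (α / 2 * coneRoot ω t z ξ) * ψ ξ)
  + 1 / (2 * ω) *
      (∫ τ in (0 : ℝ)..t, Real.exp (-(α / 2) * (t - τ)) * f τ *
        (∫ ξ in (z - ω * (t - τ))..(z + ω * (t - τ)),
          besselI0 (α / 2 * coneRoot ω (t - τ) z ξ)))

/-- `g` (considered for times `t ≥ 0` only) is a classical solution of the Cauchy problem
`g_tt = ω² g_zz - α g_t + f(t)`, `g(0, z) = φ(z)`, `g_t(0, z) = ψ(z)`: it is `C²` for `t > 0`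
and `C¹` up to `t = 0`. -/
structure IsClassicalSolution (ω α : ℝ) (f φ ψ : ℝ → ℝ) (g : ℝ → ℝ → ℝ) : Prop where
  contDiffOn_open : ContDiffOn ℝ 2 (Function.uncurry g) (Set.Ioi 0 ×ˢ Set.univ)
  contDiffOn_closed : ContDiffOn ℝ 1 (Function.uncurry g) (Set.Ici 0 ×ˢ Set.univ)
  equation : ∀ t : ℝ, 0 < t → ∀ z : ℝ,
    iteratedDeriv 2 (fun s => g s z) t
      = ω ^ 2 * iteratedDeriv 2 (fun y => g t y) z - α * deriv (fun s => g s z) t + f t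
  initial_position : ∀ z : ℝ, g 0 z = φ z
  initial_velocity : ∀ z : ℝ, HasDerivWithinAt (fun s => g s z) (ψ z) (Set.Ici 0) 0

open Set Filter Topology MeasureTheory

/-! Put `c = α / 2`. Writing `G = exp (-c t) u` turns the unforced damped equation into the
Klein–Gordon equation `u_tt = ω² u_zz + c² u`, whose propagator integrates the data against `I₀ (c
s)` over the cone. Two changes of form make everything smooth. The Bessel functions are replaced by
entire functions of the squared argument, so that neither `s` nor the quotient `I₁ / s` survives,
and `ξ = z + ω t y` moves the integrals to the fixed interval `[-1, 1]`. The equation then follows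
by differentiating under the integral (`hasDerivAt_kleinGordonDeriv_time`): what is left over is an
exact `y`-derivative with vanishing boundary values. The force does not depend on `z`, so it
contributes a one-variable Duhamel integral. `explicitG_eq_dampedWave` identifies the result with
the given formula.

Uniqueness (`IsClassicalSolution.eq_zero`): for the difference of two solutions, the derivatives in
the directions `(1, ±ω)` satisfy first-order equations along characteristics. Iterating the
resulting estimate on a backward cone bounds them by `M (|α| t)ⁿ / n!`, so they vanish.

Diffeomorphism: `φ` grows by `L` over a period and `ψ` is periodic, so `G (t, ·)` grows by a fixed
positive amount over each period. With a positive derivative it is therefore a bijection, and its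
inverse has the same regularity. -/

/-! ### Bessel–Clifford functions. -/

/-- The Bessel–Clifford function `∑ xᵐ / (m! (m + k)!)`. -/
noncomputable def besselClifford (k : ℕ) (x : ℝ) : ℝ :=
  ∑' m : ℕ, x ^ m / ((m.factorial : ℝ) * ((m + k).factorial : ℝ))

theorem summable_besselClifford (k : ℕ) (x : ℝ) :
    Summable fun m : ℕ => x ^ m / ((m.factorial : ℝ) * ((m + k).factorial : ℝ)) := by
  refine Summable.of_norm_bounded (Real.summable_pow_div_factorial |x|) fun m => ?_
  rw [norm_div, norm_pow, Real.norm_eq_abs]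
  have h1 : (1 : ℝ) ≤ ((m + k).factorial : ℝ) := by exact_mod_cast Nat.factorial_pos _
  have h2 : (0 : ℝ) < (m.factorial : ℝ) := by exact_mod_cast Nat.factorial_pos _
  rw [Real.norm_of_nonneg (by positivity)]
  gcongr
  nlinarith

/-- Termwise differentiation shifts `k` by one. On the ball of radius `|x| + 1` the differentiated
series is dominated by a shifted exponential series. -/
theorem hasDerivAt_besselClifford (k : ℕ) (x : ℝ) :
    HasDerivAt (besselClifford k) (besselClifford (k + 1) x) x := by
  set R : ℝ := |x| + 1 with hR
  have hfac (m : ℕ) : (0 : ℝ) < (m.factorial : ℝ) := by exact_mod_cast Nat.factorial_pos _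
  have hsum : Summable fun m : ℕ => (m : ℝ) * R ^ (m - 1) / (m.factorial : ℝ) := by
    rw [← summable_nat_add_iff 1]
    refine (Real.summable_pow_div_factorial R).congr fun m => ?_
    have := (hfac m).ne'
    rw [Nat.factorial_succ]
    push_cast
    field_simp
  have key := hasDerivAt_tsum_of_isPreconnected (t := Metric.ball (0 : ℝ) R)
    (g := fun (m : ℕ) (y : ℝ) => y ^ m / ((m.factorial : ℝ) * ((m + k).factorial : ℝ)))
    (g' := fun (m : ℕ) (y : ℝ) =>
      (m : ℝ) * y ^ (m - 1) / ((m.factorial : ℝ) * ((m + k).factorial : ℝ)))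
    (y := x) hsum Metric.isOpen_ball (convex_ball (0 : ℝ) R).isPreconnected
    (fun m y _ => (hasDerivAt_pow m y).div_const _)
    (fun m y hy => by
      have hy' : |y| ≤ R := by simpa using (Metric.mem_ball.1 hy).le
      have h1 : (1 : ℝ) ≤ ((m + k).factorial : ℝ) := by exact_mod_cast Nat.factorial_pos _
      have h2 := hfac m
      rw [norm_div, norm_mul, norm_pow, Real.norm_eq_abs y, Real.norm_of_nonneg (by positivity),
        Real.norm_of_nonneg (by positivity)]
      gcongr
      nlinarith)
    (Metric.mem_ball_self (by positivity)) (summable_besselClifford k 0) (by simp [hR])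
  have hshift (m : ℕ) : x ^ m / ((m.factorial : ℝ) * ((m + (k + 1)).factorial : ℝ)) =
      ((m + 1 : ℕ) : ℝ) * x ^ (m + 1 - 1) /
        (((m + 1).factorial : ℝ) * ((m + 1 + k).factorial : ℝ)) := by
    have h1 := (hfac m).ne'
    have h2 := (hfac (m + (k + 1))).ne'
    rw [Nat.factorial_succ, show m + 1 + k = m + (k + 1) by ring]
    push_cast
    field_simp
  suffices h : besselClifford (k + 1) x = ∑' m : ℕ,
      (m : ℝ) * x ^ (m - 1) / ((m.factorial : ℝ) * ((m + k).factorial : ℝ)) by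
    rw [h]
    exact key
  rw [Summable.tsum_eq_zero_add
    ((summable_nat_add_iff 1).1 ((summable_besselClifford (k + 1) x).congr hshift))]
  simp only [Nat.cast_zero, zero_mul, zero_div, zero_add]
  exact tsum_congr hshift

/-- By the derivative rule this is Bessel's equation `x B'' + (k + 1) B' = B`; the case `k = 0` is
what makes the propagator solve the Klein–Gordon equation. -/
theorem besselClifford_recurrence (k : ℕ) (x : ℝ) :
    x * besselClifford (k + 2) x + (k + 1) * besselClifford (k + 1) x = besselClifford k x := by
  have hfac (m : ℕ) : (0 : ℝ) < (m.factorial : ℝ) := by exact_mod_cast Nat.factorial_pos _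
  have hshift (m : ℕ) :
      x * (x ^ m / ((m.factorial : ℝ) * ((m + (k + 2)).factorial : ℝ))) = ((m + 1 : ℕ) : ℝ) *
        (x ^ (m + 1) / (((m + 1).factorial : ℝ) * ((m + 1 + (k + 1)).factorial : ℝ))) := by
    have h1 := (hfac m).ne'
    have h2 := (hfac (m + (k + 2))).ne'
    rw [Nat.factorial_succ, show m + 1 + (k + 1) = m + (k + 2) by ring]
    push_cast
    field_simp
    ring
  have hs : Summable fun m : ℕ =>
      (m : ℝ) * (x ^ m / ((m.factorial : ℝ) * ((m + (k + 1)).factorial : ℝ))) :=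
    (summable_nat_add_iff 1).1 (((summable_besselClifford (k + 2) x).mul_left x).congr hshift)
  have h2 : x * besselClifford (k + 2) x
      = ∑' m : ℕ, (m : ℝ) * (x ^ m / ((m.factorial : ℝ) * ((m + (k + 1)).factorial : ℝ))) := by
    rw [hs.tsum_eq_zero_add]
    simp only [Nat.cast_zero, zero_mul, zero_add, besselClifford]
    rw [← tsum_mul_left]
    exact tsum_congr hshift
  rw [h2, besselClifford, besselClifford, ← tsum_mul_left,
    ← hs.tsum_add ((summable_besselClifford (k + 1) x).mul_left _)]
  refine tsum_congr fun m => ?_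
  have h1 := (hfac m).ne'
  have h2 := (hfac (m + k)).ne'
  rw [← add_assoc, Nat.factorial_succ]
  push_cast
  field_simp
  ring

theorem contDiff_besselClifford (n k : ℕ) : ContDiff ℝ n (besselClifford k) := by
  induction n generalizing k with
  | zero =>
    exact contDiff_zero.2 (continuous_iff_continuousAt.2 fun x =>
      (hasDerivAt_besselClifford k x).continuousAt)
  | succ n ih =>
    rw [show ((n + 1 : ℕ) : WithTop ℕ∞) = (n : WithTop ℕ∞) + 1 by push_cast; rfl,
      contDiff_succ_iff_deriv]
    refine ⟨fun x => (hasDerivAt_besselClifford k x).differentiableAt, by simp, ?_⟩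
    rw [funext fun x => (hasDerivAt_besselClifford k x).deriv]
    exact ih (k + 1)

theorem besselClifford_zero_zero : besselClifford 0 0 = 1 := by
  rw [besselClifford, tsum_eq_single 0 fun m hm => by simp [hm]]
  simp

theorem besselClifford_nonneg (k : ℕ) {x : ℝ} (hx : 0 ≤ x) : 0 ≤ besselClifford k x :=
  tsum_nonneg fun m => by positivity

theorem besselI0_eq_besselClifford (x : ℝ) : besselI0 x = besselClifford 0 (x ^ 2 / 4) := by
  refine tsum_congr fun m => ?_
  rw [Real.Gamma_nat_eq_factorial, add_zero, pow_mul, div_pow]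
  norm_num
  ring

/-- The explicit factor `x / 2` is what cancels the denominator `s` in `I₁ (c s) / s`. -/
theorem besselI1_eq_besselClifford (x : ℝ) :
    besselI1 x = x / 2 * besselClifford 1 (x ^ 2 / 4) := by
  rw [besselI1, besselClifford, ← tsum_mul_left]
  refine tsum_congr fun m => ?_
  rw [show (m : ℝ) + 2 = ((m + 1 : ℕ) : ℝ) + 1 by push_cast; ring, Real.Gamma_nat_eq_factorial,
    pow_succ, pow_mul, div_pow]
  norm_num
  ring

/-! ### Integrals depending on a parameter. -/

theorem hasDerivAt_intervalIntegral_of_continuous {a b : ℝ} {F F' : ℝ → ℝ → ℝ}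
    (hF : Continuous (Function.uncurry F)) (hF' : Continuous (Function.uncurry F'))
    (h : ∀ x y, HasDerivAt (fun x => F x y) (F' x y) x) (x : ℝ) :
    HasDerivAt (fun x => ∫ y in a..b, F x y) (∫ y in a..b, F' x y) x := by
  obtain ⟨C, hC⟩ := ((isCompact_closedBall x 1).prod
    (isCompact_uIcc (a := a) (b := b))).exists_bound_of_continuousOn hF'.continuousOn
  refine (intervalIntegral.hasDerivAt_integral_of_dominated_loc_of_deriv_le (bound := fun _ => C)
    (Metric.closedBall_mem_nhds x one_pos) (.of_forall fun x => ?_) ?_ ?_ ?_ ?_ ?_).2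
  · exact (hF.comp (Continuous.prodMk_right x)).aestronglyMeasurable
  · exact (hF.comp (Continuous.prodMk_right x)).intervalIntegrable _ _
  · exact (hF'.comp (Continuous.prodMk_right x)).aestronglyMeasurable
  · exact .of_forall fun y hy x' hx' => hC (x', y) ⟨hx', uIoc_subset_uIcc hy⟩
  · exact intervalIntegrable_const
  · exact .of_forall fun y _ x' _ => h x' y

/-- Induction on `n` with `E` general, because the derivative is again such an integral, with values
in `H →L[ℝ] E`. -/
theorem contDiff_intervalIntegral {H : Type} [NormedAddCommGroup H] [NormedSpace ℝ H]
    [ProperSpace H] {E : Type} [NormedAddCommGroup E] [NormedSpace ℝ E] [CompleteSpace E]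
    {a b : ℝ} {n : ℕ} {F : H → ℝ → E} (hF : ContDiff ℝ n (Function.uncurry F)) :
    ContDiff ℝ n fun x => ∫ y in a..b, F x y := by
  induction n generalizing E with
  | zero =>
    exact contDiff_zero.2 <|
      intervalIntegral.continuous_parametric_intervalIntegral_of_continuous' hF.continuous a b
  | succ n ih =>
    set F' : H → ℝ → H →L[ℝ] E := fun x y =>
      (fderiv ℝ (Function.uncurry F) (x, y)).comp (ContinuousLinearMap.inl ℝ H ℝ) with hF'def
    have hF' : ContDiff ℝ n (Function.uncurry F') := by
      have := hF.fderiv_right (m := n) (by norm_cast)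
      exact this.clm_comp contDiff_const
    have hd (x : H) (y : ℝ) : HasFDerivAt (fun x => F x y) (F' x y) x := by
      have h1 := (hF.differentiable (by simp) (x, y)).hasFDerivAt
      exact h1.comp x (hasFDerivAt_prodMk_left (𝕜 := ℝ) x y)
    refine contDiff_succ_iff_hasFDerivAt.2 ⟨fun x => ∫ y in a..b, F' x y, ih hF', fun x => ?_⟩
    obtain ⟨C, hC⟩ := ((isCompact_closedBall x 1).prod
      (isCompact_uIcc (a := a) (b := b))).exists_bound_of_continuousOn hF'.continuous.continuousOn
    refine intervalIntegral.hasFDerivAt_integral_of_dominated_of_fderiv_le (bound := fun _ => C)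
      (Metric.closedBall_mem_nhds x one_pos) (.of_forall fun x => ?_) ?_ ?_ ?_ ?_ ?_
    · exact (hF.continuous.comp (Continuous.prodMk_right x)).aestronglyMeasurable
    · exact (hF.continuous.comp (Continuous.prodMk_right x)).intervalIntegrable _ _
    · exact (hF'.continuous.comp (Continuous.prodMk_right x)).aestronglyMeasurable
    · exact .of_forall fun y hy x' hx' => hC (x', y) ⟨hx', uIoc_subset_uIcc hy⟩
    · exact intervalIntegrable_const
    · exact .of_forall fun y _ x' _ => hd x' y

/-! ### Klein–Gordon propagators. -/

/-- The solution of the Klein–Gordon equation `u_tt = ω² u_zz + c² u` with `u(0, z) = 0` and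
`u_t(0, z) = φ z`. -/
noncomputable def kleinGordon (c ω : ℝ) (φ : ℝ → ℝ) (t z : ℝ) : ℝ :=
  ∫ y in (-1 : ℝ)..1,
    t / 2 * besselClifford 0 (c ^ 2 / 4 * (t ^ 2 * (1 - y ^ 2))) * φ (z + ω * t * y)

/-- The time derivative of `kleinGordon`; it solves the Klein–Gordon equation with `u(0, z) = φ z`
and `u_t(0, z) = 0`. -/
noncomputable def kleinGordonDeriv (c ω : ℝ) (φ : ℝ → ℝ) (t z : ℝ) : ℝ :=
  ∫ y in (-1 : ℝ)..1,
    ((1 / 2 * besselClifford 0 (c ^ 2 / 4 * (t ^ 2 * (1 - y ^ 2))) +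
      c ^ 2 / 4 * (t ^ 2 * (1 - y ^ 2)) *
        besselClifford 1 (c ^ 2 / 4 * (t ^ 2 * (1 - y ^ 2)))) * φ (z + ω * t * y) +
    t / 2 * (ω * y) * besselClifford 0 (c ^ 2 / 4 * (t ^ 2 * (1 - y ^ 2))) *
      deriv φ (z + ω * t * y))

theorem continuous_besselClifford (k : ℕ) : Continuous (besselClifford k) :=
  (contDiff_besselClifford 0 k).continuous

section kleinGordon

variable {c ω : ℝ} {φ : ℝ → ℝ}

theorem ContDiff.hasDerivAt_of_ne_zero {n : WithTop ℕ∞} (hφ : ContDiff ℝ n φ) (hn : n ≠ 0)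
    (x : ℝ) : HasDerivAt φ (deriv φ x) x :=
  (hφ.differentiable hn x).hasDerivAt

theorem hasDerivAt_besselClifford_comp (k : ℕ) (y t : ℝ) :
    HasDerivAt (fun t => besselClifford k (c ^ 2 / 4 * (t ^ 2 * (1 - y ^ 2))))
      (besselClifford (k + 1) (c ^ 2 / 4 * (t ^ 2 * (1 - y ^ 2))) *
        (c ^ 2 / 4 * (2 * t * (1 - y ^ 2)))) t := by
  refine (hasDerivAt_besselClifford k _).comp t ?_
  exact (((hasDerivAt_pow 2 t).mul_const (1 - y ^ 2)).const_mul (c ^ 2 / 4)).congr_deriv (by simp)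

theorem hasDerivAt_besselClifford_comp_space (k : ℕ) (y t : ℝ) :
    HasDerivAt (fun y => besselClifford k (c ^ 2 / 4 * (t ^ 2 * (1 - y ^ 2))))
      (besselClifford (k + 1) (c ^ 2 / 4 * (t ^ 2 * (1 - y ^ 2))) *
        (c ^ 2 / 4 * (t ^ 2 * (-(2 * y))))) y := by
  refine (hasDerivAt_besselClifford k _).comp y ?_
  exact ((((hasDerivAt_pow 2 y).const_sub 1).const_mul (t ^ 2)).const_mul
    (c ^ 2 / 4)).congr_deriv (by simp)

theorem HasDerivAt.comp_ray_time {χ χ' : ℝ → ℝ} (h : ∀ x, HasDerivAt χ (χ' x) x) (z y t : ℝ) :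
    HasDerivAt (fun t => χ (z + ω * t * y)) (χ' (z + ω * t * y) * (ω * y)) t := by
  refine (h _).comp t ?_
  exact ((((hasDerivAt_id' t).const_mul ω).mul_const y).const_add z).congr_deriv (by ring)

theorem HasDerivAt.comp_ray_space {χ χ' : ℝ → ℝ} (h : ∀ x, HasDerivAt χ (χ' x) x) (z y t : ℝ) :
    HasDerivAt (fun y => χ (z + ω * t * y)) (χ' (z + ω * t * y) * (ω * t)) y := by
  refine (h _).comp y ?_
  exact (((hasDerivAt_id' y).const_mul (ω * t)).const_add z).congr_deriv (by ring)

theorem HasDerivAt.comp_ray_shift {χ χ' : ℝ → ℝ} (h : ∀ x, HasDerivAt χ (χ' x) x) (z y t : ℝ) :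
    HasDerivAt (fun z => χ (z + ω * t * y)) (χ' (z + ω * t * y)) z :=
  (h _).comp_add_const z _

theorem contDiff_kleinGordon {n : ℕ} (hφ : ContDiff ℝ n φ) :
    ContDiff ℝ n (Function.uncurry (kleinGordon c ω φ)) := by
  refine contDiff_intervalIntegral (F := fun (p : ℝ × ℝ) y =>
    p.1 / 2 * besselClifford 0 (c ^ 2 / 4 * (p.1 ^ 2 * (1 - y ^ 2))) * φ (p.2 + ω * p.1 * y)) ?_
  have h0 := contDiff_besselClifford n 0
  unfold Function.uncurry
  fun_prop

theorem contDiff_kleinGordonDeriv {n : ℕ} (hφ : ContDiff ℝ (n + 1) φ) :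
    ContDiff ℝ n (Function.uncurry (kleinGordonDeriv c ω φ)) := by
  refine contDiff_intervalIntegral (F := fun (p : ℝ × ℝ) y =>
    ((1 / 2 * besselClifford 0 (c ^ 2 / 4 * (p.1 ^ 2 * (1 - y ^ 2))) +
      c ^ 2 / 4 * (p.1 ^ 2 * (1 - y ^ 2)) *
        besselClifford 1 (c ^ 2 / 4 * (p.1 ^ 2 * (1 - y ^ 2)))) * φ (p.2 + ω * p.1 * y) +
    p.1 / 2 * (ω * y) * besselClifford 0 (c ^ 2 / 4 * (p.1 ^ 2 * (1 - y ^ 2))) *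
      deriv φ (p.2 + ω * p.1 * y))) ?_
  have h0 := contDiff_besselClifford n 0
  have h1 := contDiff_besselClifford n 1
  have h2 : ContDiff ℝ n (deriv φ) := (contDiff_succ_iff_deriv.1 hφ).2.2
  have h3 : ContDiff ℝ n φ := hφ.of_le (by exact_mod_cast n.le_succ)
  unfold Function.uncurry
  fun_prop

theorem hasDerivAt_kleinGordon_time (hφ : ContDiff ℝ 1 φ) (t z : ℝ) :
    HasDerivAt (fun t => kleinGordon c ω φ t z) (kleinGordonDeriv c ω φ t z) t := by
  have h0 := continuous_besselClifford 0
  have h1 := continuous_besselClifford 1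
  have h2 : Continuous (deriv φ) := hφ.continuous_deriv le_rfl
  have h3 := hφ.continuous
  refine hasDerivAt_intervalIntegral_of_continuous
    (F := fun t y => t / 2 * besselClifford 0 (c ^ 2 / 4 * (t ^ 2 * (1 - y ^ 2))) *
      φ (z + ω * t * y))
    (F' := fun t y => ((1 / 2 * besselClifford 0 (c ^ 2 / 4 * (t ^ 2 * (1 - y ^ 2))) +
      c ^ 2 / 4 * (t ^ 2 * (1 - y ^ 2)) *
        besselClifford 1 (c ^ 2 / 4 * (t ^ 2 * (1 - y ^ 2)))) * φ (z + ω * t * y) +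
    t / 2 * (ω * y) * besselClifford 0 (c ^ 2 / 4 * (t ^ 2 * (1 - y ^ 2))) *
      deriv φ (z + ω * t * y))) ?_ ?_ (fun t y => ?_) t
  · unfold Function.uncurry; fun_prop
  · unfold Function.uncurry; fun_prop
  · have hφ' := HasDerivAt.comp_ray_time (ω := ω)
      (hφ.hasDerivAt_of_ne_zero one_ne_zero) z y t
    refine ((((hasDerivAt_id' t).div_const 2).mul
      (hasDerivAt_besselClifford_comp (c := c) 0 y t)).mul hφ').congr_deriv ?_
    simp only [Nat.reduceAdd, Pi.mul_apply]
    ring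

theorem hasDerivAt_kleinGordon_space (hφ : ContDiff ℝ 1 φ) (t z : ℝ) :
    HasDerivAt (fun z => kleinGordon c ω φ t z) (kleinGordon c ω (deriv φ) t z) z := by
  have h0 := continuous_besselClifford 0
  have h2 : Continuous (deriv φ) := hφ.continuous_deriv le_rfl
  have h3 := hφ.continuous
  refine hasDerivAt_intervalIntegral_of_continuous
    (F := fun z y => t / 2 * besselClifford 0 (c ^ 2 / 4 * (t ^ 2 * (1 - y ^ 2))) *
      φ (z + ω * t * y))
    (F' := fun z y => t / 2 * besselClifford 0 (c ^ 2 / 4 * (t ^ 2 * (1 - y ^ 2))) *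
      deriv φ (z + ω * t * y)) ?_ ?_ (fun z y => ?_) z
  · unfold Function.uncurry; fun_prop
  · unfold Function.uncurry; fun_prop
  · exact (HasDerivAt.comp_ray_shift (hφ.hasDerivAt_of_ne_zero one_ne_zero) z y t).const_mul _

theorem hasDerivAt_kleinGordonDeriv_space (hφ : ContDiff ℝ 2 φ) (t z : ℝ) :
    HasDerivAt (fun z => kleinGordonDeriv c ω φ t z) (kleinGordonDeriv c ω (deriv φ) t z) z := by
  have h0 := continuous_besselClifford 0
  have h1 := continuous_besselClifford 1
  have hφ1 : ContDiff ℝ 1 (deriv φ) := hφ.deriv'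
  have h2 : Continuous (deriv (deriv φ)) := hφ1.continuous_deriv le_rfl
  have h3 := hφ.continuous
  have h4 := hφ1.continuous
  refine hasDerivAt_intervalIntegral_of_continuous
    (F := fun z y => ((1 / 2 * besselClifford 0 (c ^ 2 / 4 * (t ^ 2 * (1 - y ^ 2))) +
      c ^ 2 / 4 * (t ^ 2 * (1 - y ^ 2)) *
        besselClifford 1 (c ^ 2 / 4 * (t ^ 2 * (1 - y ^ 2)))) * φ (z + ω * t * y) +
      t / 2 * (ω * y) * besselClifford 0 (c ^ 2 / 4 * (t ^ 2 * (1 - y ^ 2))) *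
      deriv φ (z + ω * t * y)))
    (F' := fun z y => ((1 / 2 * besselClifford 0 (c ^ 2 / 4 * (t ^ 2 * (1 - y ^ 2))) +
      c ^ 2 / 4 * (t ^ 2 * (1 - y ^ 2)) *
        besselClifford 1 (c ^ 2 / 4 * (t ^ 2 * (1 - y ^ 2)))) * deriv φ (z + ω * t * y) +
      t / 2 * (ω * y) * besselClifford 0 (c ^ 2 / 4 * (t ^ 2 * (1 - y ^ 2))) *
      deriv (deriv φ) (z + ω * t * y))) ?_ ?_ (fun z y => ?_) z
  · unfold Function.uncurry; fun_prop
  · unfold Function.uncurry; fun_prop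
  · exact ((HasDerivAt.comp_ray_shift
      (hφ.hasDerivAt_of_ne_zero two_ne_zero) z y t).const_mul _).add
      ((HasDerivAt.comp_ray_shift (hφ1.hasDerivAt_of_ne_zero one_ne_zero) z y t).const_mul _)

/-- The equation does not hold integrand by integrand: the two sides differ by the `y`-derivative of
`B`, whose factor `1 - y ^ 2` kills it at both ends. -/
theorem hasDerivAt_kleinGordonDeriv_time (hφ : ContDiff ℝ 2 φ) (t z : ℝ) :
    HasDerivAt (fun t => kleinGordonDeriv c ω φ t z)
      (ω ^ 2 * kleinGordon c ω (deriv (deriv φ)) t z + c ^ 2 * kleinGordon c ω φ t z) t := by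
  have h0 := continuous_besselClifford 0
  have h1 := continuous_besselClifford 1
  have h1' := continuous_besselClifford 2
  have hφ1 : ContDiff ℝ 1 (deriv φ) := hφ.deriv'
  have h2 : Continuous (deriv (deriv φ)) := hφ1.continuous_deriv le_rfl
  have h3 := hφ.continuous
  have h4 := hφ1.continuous
  have hd := hφ.hasDerivAt_of_ne_zero two_ne_zero
  have hd1 := hφ1.hasDerivAt_of_ne_zero one_ne_zero
  set B : ℝ → ℝ := fun y => (1 - y ^ 2) *
    (t * y * (c ^ 2 / 4 * besselClifford 1 (c ^ 2 / 4 * (t ^ 2 * (1 - y ^ 2)))) *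
        φ (z + ω * t * y) -
      ω / 2 * besselClifford 0 (c ^ 2 / 4 * (t ^ 2 * (1 - y ^ 2))) * deriv φ (z + ω * t * y))
  set P : ℝ → ℝ := fun y =>
    t / 2 * besselClifford 0 (c ^ 2 / 4 * (t ^ 2 * (1 - y ^ 2))) *
      deriv (deriv φ) (z + ω * t * y) with hP
  set Q : ℝ → ℝ := fun y =>
    t / 2 * besselClifford 0 (c ^ 2 / 4 * (t ^ 2 * (1 - y ^ 2))) * φ (z + ω * t * y) with hQ
  set gtt : ℝ → ℝ → ℝ := fun t y =>
    (3 * t * (1 - y ^ 2) * (c ^ 2 / 4) * besselClifford 1 (c ^ 2 / 4 * (t ^ 2 * (1 - y ^ 2))) +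
      2 * t ^ 3 * (1 - y ^ 2) ^ 2 * (c ^ 2 / 4) ^ 2 *
        besselClifford 2 (c ^ 2 / 4 * (t ^ 2 * (1 - y ^ 2)))) * φ (z + ω * t * y) +
    (ω * y * besselClifford 0 (c ^ 2 / 4 * (t ^ 2 * (1 - y ^ 2))) +
      2 * t ^ 2 * (1 - y ^ 2) * ω * y * (c ^ 2 / 4) *
        besselClifford 1 (c ^ 2 / 4 * (t ^ 2 * (1 - y ^ 2)))) * deriv φ (z + ω * t * y) +
    t / 2 * ω ^ 2 * y ^ 2 * besselClifford 0 (c ^ 2 / 4 * (t ^ 2 * (1 - y ^ 2))) *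
      deriv (deriv φ) (z + ω * t * y) with hgtt
  have hgttc : Continuous (Function.uncurry gtt) := by
    unfold Function.uncurry; fun_prop
  have hPc : Continuous P := by fun_prop
  have hQc : Continuous Q := by fun_prop
  have key : HasDerivAt (fun t => kleinGordonDeriv c ω φ t z) (∫ y in (-1 : ℝ)..1, gtt t y) t := by
    refine hasDerivAt_intervalIntegral_of_continuous
      (F := fun t y => ((1 / 2 * besselClifford 0 (c ^ 2 / 4 * (t ^ 2 * (1 - y ^ 2))) +
        c ^ 2 / 4 * (t ^ 2 * (1 - y ^ 2)) *
          besselClifford 1 (c ^ 2 / 4 * (t ^ 2 * (1 - y ^ 2)))) * φ (z + ω * t * y) +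
        t / 2 * (ω * y) * besselClifford 0 (c ^ 2 / 4 * (t ^ 2 * (1 - y ^ 2))) *
          deriv φ (z + ω * t * y))) (F' := gtt) ?_ hgttc (fun t y => ?_) t
    · unfold Function.uncurry; fun_prop
    · have e0 := hasDerivAt_besselClifford_comp (c := c) 0 y t
      have e1 := hasDerivAt_besselClifford_comp (c := c) 1 y t
      have eq : HasDerivAt (fun t => c ^ 2 / 4 * (t ^ 2 * (1 - y ^ 2)))
          (c ^ 2 / 4 * (2 * t * (1 - y ^ 2))) t := by
        exact (((hasDerivAt_pow 2 t).mul_const (1 - y ^ 2)).const_mul (c ^ 2 / 4)).congr_deriv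
          (by simp)
      have f0 := HasDerivAt.comp_ray_time (ω := ω) hd z y t
      have f1 := HasDerivAt.comp_ray_time (ω := ω) hd1 z y t
      refine ((((e0.const_mul (1 / 2)).add (eq.mul e1)).mul f0).add
        (((((hasDerivAt_id' t).div_const 2).mul_const (ω * y)).mul e0).mul f1)).congr_deriv ?_
      simp only [Nat.reduceAdd, hgtt, Pi.mul_apply, Pi.add_apply]
      ring
  refine key.congr_deriv ?_
  have hB : ∫ y in (-1 : ℝ)..1, (gtt t y - (ω ^ 2 * P y + c ^ 2 * Q y)) = B 1 - B (-1) := by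
    refine intervalIntegral.integral_eq_sub_of_hasDerivAt (fun y _ => ?_) ?_
    · have e0 := hasDerivAt_besselClifford_comp_space (c := c) 0 y t
      have e1 := hasDerivAt_besselClifford_comp_space (c := c) 1 y t
      have f0 := HasDerivAt.comp_ray_space (ω := ω) hd z y t
      have f1 := HasDerivAt.comp_ray_space (ω := ω) hd1 z y t
      have hrec := besselClifford_recurrence 0 (c ^ 2 / 4 * (t ^ 2 * (1 - y ^ 2)))
      refine (((hasDerivAt_pow 2 y).const_sub 1).mul
        (((((hasDerivAt_id' y).const_mul t).mul (e1.const_mul (c ^ 2 / 4))).mul f0).sub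
          ((e0.const_mul (ω / 2)).mul f1))).congr_deriv ?_
      simp only [hgtt, hP, hQ, Pi.mul_apply, Pi.sub_apply]
      norm_num at hrec ⊢
      -- Bessel's equation absorbs the mass term `c ^ 2 * Q y`; all other terms cancel
      -- algebraically.
      linear_combination -(c ^ 2 * t / 2 * φ (z + ω * t * y)) * hrec
    · refine Continuous.intervalIntegrable ?_ _ _
      have : Continuous (gtt t) := hgttc.comp (Continuous.prodMk_right t)
      fun_prop
  have hB0 : B 1 - B (-1) = 0 := by simp [B]
  have hg : Continuous (gtt t) := hgttc.comp (Continuous.prodMk_right t)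
  have hPc' : Continuous fun y => ω ^ 2 * P y := by fun_prop
  have hQc' : Continuous fun y => c ^ 2 * Q y := by fun_prop
  have hPQ : Continuous fun y => ω ^ 2 * P y + c ^ 2 * Q y := by fun_prop
  rw [hB0, intervalIntegral.integral_sub (hg.intervalIntegrable _ _)
      (hPQ.intervalIntegrable _ _),
    intervalIntegral.integral_add (hPc'.intervalIntegrable _ _) (hQc'.intervalIntegrable _ _),
    intervalIntegral.integral_const_mul, intervalIntegral.integral_const_mul, sub_eq_zero] at hB
  exact hB

theorem kleinGordon_zero (z : ℝ) : kleinGordon c ω φ 0 z = 0 := by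
  simp [kleinGordon]

theorem kleinGordonDeriv_zero (z : ℝ) : kleinGordonDeriv c ω φ 0 z = φ z := by
  simp [kleinGordonDeriv, besselClifford_zero_zero]
  ring

/-- Integration by parts removes `deriv φ`; the boundary values are the d'Alembert average. This
form matches the explicit formula and costs no derivative of `φ`. -/
theorem kleinGordonDeriv_eq (hφ : ContDiff ℝ 1 φ) (t z : ℝ) :
    kleinGordonDeriv c ω φ t z = (φ (z + ω * t) + φ (z - ω * t)) / 2 +
      ∫ y in (-1 : ℝ)..1, t ^ 2 * (c ^ 2 / 4) *
        besselClifford 1 (c ^ 2 / 4 * (t ^ 2 * (1 - y ^ 2))) * φ (z + ω * t * y) := by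
  have h0 := continuous_besselClifford 0
  have h1 := continuous_besselClifford 1
  have h2 : Continuous (deriv φ) := hφ.continuous_deriv le_rfl
  have h3 := hφ.continuous
  rw [← sub_eq_iff_eq_add, kleinGordonDeriv, ← intervalIntegral.integral_sub]
  · rw [intervalIntegral.integral_eq_sub_of_hasDerivAt
      (f := fun y => 1 / 2 * y * besselClifford 0 (c ^ 2 / 4 * (t ^ 2 * (1 - y ^ 2))) *
        φ (z + ω * t * y)) (fun y _ => ?_)]
    · simp [besselClifford_zero_zero]
      ring_nf
    · exact Continuous.intervalIntegrable (by fun_prop) _ _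
    · have e0 := hasDerivAt_besselClifford_comp_space (c := c) 0 y t
      have f0 := HasDerivAt.comp_ray_space (ω := ω)
        (hφ.hasDerivAt_of_ne_zero one_ne_zero) z y t
      refine ((((hasDerivAt_id' y).const_mul (1 / 2)).mul e0).mul f0).congr_deriv ?_
      simp only [Nat.reduceAdd, Pi.mul_apply]
      ring
  · exact Continuous.intervalIntegrable (by fun_prop) _ _
  · exact Continuous.intervalIntegrable (by fun_prop) _ _

end kleinGordon

/-! ### The forcing term. -/

/-- The Duhamel integral `∫₀ᵗ k (t - τ) f τ dτ`, rescaled to the unit interval. -/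
noncomputable def duhamel (k f : ℝ → ℝ) (t : ℝ) : ℝ :=
  t * ∫ x in (0 : ℝ)..1, k (t * (1 - x)) * f (t * x)

theorem duhamel_eq_integral (k f : ℝ → ℝ) (t : ℝ) :
    duhamel k f t = ∫ τ in (0 : ℝ)..t, k (t - τ) * f τ := by
  have := intervalIntegral.mul_integral_comp_mul_left (a := 0) (b := 1)
    (f := fun τ => k (t - τ) * f τ) t
  rw [mul_zero, mul_one] at this
  rw [← this, duhamel]
  simp only [mul_sub, mul_one]

theorem hasDerivAt_duhamel {k f : ℝ → ℝ} (hk : ContDiff ℝ 1 k) (hf : ContDiff ℝ 1 f) (t : ℝ) :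
    HasDerivAt (duhamel k f) (k 0 * f t + duhamel (deriv k) f t) t := by
  have hkc := hk.continuous
  have hfc := hf.continuous
  have hk'c : Continuous (deriv k) := hk.continuous_deriv le_rfl
  have hf'c : Continuous (deriv f) := hf.continuous_deriv le_rfl
  have hkd := hk.hasDerivAt_of_ne_zero one_ne_zero
  have hfd := hf.hasDerivAt_of_ne_zero one_ne_zero
  have hI : HasDerivAt (fun t => ∫ x in (0 : ℝ)..1, k (t * (1 - x)) * f (t * x))
      (∫ x in (0 : ℝ)..1, (deriv k (t * (1 - x)) * (1 - x) * f (t * x) +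
        k (t * (1 - x)) * (deriv f (t * x) * x))) t := by
    refine hasDerivAt_intervalIntegral_of_continuous
      (F := fun t x => k (t * (1 - x)) * f (t * x))
      (F' := fun t x => deriv k (t * (1 - x)) * (1 - x) * f (t * x) +
        k (t * (1 - x)) * (deriv f (t * x) * x)) ?_ ?_ (fun t x => ?_) t
    · unfold Function.uncurry; fun_prop
    · unfold Function.uncurry; fun_prop
    · have e0 : HasDerivAt (fun t => k (t * (1 - x))) (deriv k (t * (1 - x)) * (1 - x)) t :=
        (hkd _).comp t (((hasDerivAt_id' t).mul_const (1 - x)).congr_deriv (one_mul _))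
      have e1 : HasDerivAt (fun t => f (t * x)) (deriv f (t * x) * x) t :=
        (hfd _).comp t (((hasDerivAt_id' t).mul_const x).congr_deriv (one_mul _))
      exact e0.mul e1
  refine ((hasDerivAt_id' t).mul hI).congr_deriv ?_
  -- The integrand is the exact `x`-derivative of `x * k (t * (1 - x)) * f (t * x)`, so only the
  -- endpoint `x = 1` contributes.
  have hB : ∫ x in (0 : ℝ)..1, (k (t * (1 - x)) * f (t * x) +
      t * (deriv k (t * (1 - x)) * (1 - x) * f (t * x) + k (t * (1 - x)) * (deriv f (t * x) * x)) -
        t * (deriv k (t * (1 - x)) * f (t * x))) = k 0 * f t := by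
    rw [intervalIntegral.integral_eq_sub_of_hasDerivAt
      (f := fun x => x * k (t * (1 - x)) * f (t * x)) (fun x _ => ?_)]
    · simp
    · exact Continuous.intervalIntegrable (by fun_prop) _ _
    · have e0 : HasDerivAt (fun x => k (t * (1 - x))) (deriv k (t * (1 - x)) * (-t)) x :=
        (hkd _).comp x ((((hasDerivAt_id' x).const_sub 1).const_mul t).congr_deriv (by ring))
      have e1 : HasDerivAt (fun x => f (t * x)) (deriv f (t * x) * t) x :=
        (hfd _).comp x (((hasDerivAt_id' x).const_mul t).congr_deriv (by ring))
      refine (((hasDerivAt_id' x).mul e0).mul e1).congr_deriv ?_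
      simp only [Pi.mul_apply]
      ring
  rw [← hB, duhamel, one_mul, ← intervalIntegral.integral_const_mul,
    ← intervalIntegral.integral_const_mul, ← intervalIntegral.integral_add,
    ← intervalIntegral.integral_add]
  · congr 1
    funext x
    ring
  all_goals exact Continuous.intervalIntegrable (by fun_prop) _ _

theorem duhamel_zero (k f : ℝ → ℝ) : duhamel k f 0 = 0 := by simp [duhamel]

theorem duhamel_const_mul (a : ℝ) (k f : ℝ → ℝ) (t : ℝ) :
    duhamel (fun s => a * k s) f t = a * duhamel k f t := by
  simp only [duhamel, mul_assoc, intervalIntegral.integral_const_mul]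
  ring

theorem contDiff_duhamel {k f : ℝ → ℝ} {n : ℕ} (hk : ContDiff ℝ n k) (hf : ContDiff ℝ n f) :
    ContDiff ℝ n (duhamel k f) := by
  refine contDiff_id.mul (contDiff_intervalIntegral
    (F := fun t x => k (t * (1 - x)) * f (t * x)) ?_)
  unfold Function.uncurry
  fun_prop

/-- The response of the damped oscillator `k'' + 2 c k' = 0` with `k 0 = 0`, `k' 0 = 1`. -/
noncomputable def impulseResponse (c ω : ℝ) (s : ℝ) : ℝ :=
  Real.exp (-c * s) * kleinGordon c ω (fun _ => 1) s 0

theorem hasDerivAt_exp_neg_mul (c t : ℝ) :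
    HasDerivAt (fun t => Real.exp (-c * t)) (-c * Real.exp (-c * t)) t :=
  (((hasDerivAt_id' t).const_mul (-c)).exp).congr_deriv (by ring)

theorem contDiff_impulseResponse (c ω : ℝ) (n : ℕ) : ContDiff ℝ n (impulseResponse c ω) := by
  have h : ContDiff ℝ n (Function.uncurry (kleinGordon c ω (fun _ => 1))) :=
    contDiff_kleinGordon contDiff_const
  have h' : ContDiff ℝ n (fun s : ℝ => kleinGordon c ω (fun _ => 1) s 0) :=
    h.comp (f := fun s : ℝ => (s, (0 : ℝ))) (contDiff_id.prodMk contDiff_const)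
  unfold impulseResponse
  fun_prop

theorem hasDerivAt_impulseResponse (c ω t : ℝ) :
    HasDerivAt (impulseResponse c ω) (Real.exp (-c * t) *
      (kleinGordonDeriv c ω (fun _ => 1) t 0 - c * kleinGordon c ω (fun _ => 1) t 0)) t :=
  ((hasDerivAt_exp_neg_mul c t).mul
    (hasDerivAt_kleinGordon_time contDiff_const t 0)).congr_deriv (by ring)

theorem kleinGordon_zero_fun (c ω t z : ℝ) : kleinGordon c ω (fun _ => 0) t z = 0 := by
  simp [kleinGordon]

/-- For constant data the spatial term drops out and Klein–Gordon becomes `K'' = c² K`; the factor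
`exp (-c t)` turns this into the damped equation. -/
theorem hasDerivAt_deriv_impulseResponse (c ω t : ℝ) :
    HasDerivAt (deriv (impulseResponse c ω)) (-(2 * c) * deriv (impulseResponse c ω) t) t := by
  rw [funext fun t => (hasDerivAt_impulseResponse c ω t).deriv]
  refine ((hasDerivAt_exp_neg_mul c t).mul
    ((hasDerivAt_kleinGordonDeriv_time contDiff_const t 0).sub
      ((hasDerivAt_kleinGordon_time contDiff_const t 0).const_mul c))).congr_deriv ?_
  simp only [deriv_const', Pi.sub_apply, kleinGordon_zero_fun]
  ring

theorem impulseResponse_zero (c ω : ℝ) : impulseResponse c ω 0 = 0 := by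
  simp [impulseResponse, kleinGordon_zero]

theorem deriv_impulseResponse_zero (c ω : ℝ) : deriv (impulseResponse c ω) 0 = 1 := by
  simp [(hasDerivAt_impulseResponse c ω 0).deriv, kleinGordon_zero, kleinGordonDeriv_zero]

/-! ### Solving the damped Cauchy problem. -/

/-- The solution of the damped wave equation with damping `2 c` in terms of the Klein–Gordon
propagators. -/
noncomputable def dampedWave (c ω : ℝ) (f φ ψ : ℝ → ℝ) (t z : ℝ) : ℝ :=
  Real.exp (-c * t) *
      (kleinGordonDeriv c ω φ t z + c * kleinGordon c ω φ t z + kleinGordon c ω ψ t z) +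
    duhamel (impulseResponse c ω) f t

section dampedWave

variable {c ω : ℝ} {f φ ψ : ℝ → ℝ}

theorem contDiff_dampedWave (hf : ContDiff ℝ 2 f) (hφ : ContDiff ℝ 3 φ) (hψ : ContDiff ℝ 2 ψ) :
    ContDiff ℝ 2 (Function.uncurry (dampedWave c ω f φ ψ)) := by
  have h1 : ContDiff ℝ 2 (Function.uncurry (kleinGordonDeriv c ω φ)) :=
    contDiff_kleinGordonDeriv (n := 2) (by exact_mod_cast hφ)
  have h2 : ContDiff ℝ 2 (Function.uncurry (kleinGordon c ω φ)) :=
    contDiff_kleinGordon (n := 2) (hφ.of_le (by norm_num))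
  have h3 : ContDiff ℝ 2 (Function.uncurry (kleinGordon c ω ψ)) := contDiff_kleinGordon (n := 2) hψ
  have h4 : ContDiff ℝ 2 (duhamel (impulseResponse c ω) f) :=
    contDiff_duhamel (n := 2) (contDiff_impulseResponse c ω 2) hf
  unfold Function.uncurry at h1 h2 h3 ⊢
  unfold dampedWave
  fun_prop

theorem hasDerivAt_duhamel_impulseResponse (hf : ContDiff ℝ 1 f) (t : ℝ) :
    HasDerivAt (duhamel (impulseResponse c ω) f)
      (duhamel (deriv (impulseResponse c ω)) f t) t := by
  simpa [impulseResponse_zero] using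
    hasDerivAt_duhamel (contDiff_impulseResponse c ω 1) hf t

/-- The source `f t` comes from `k' 0 = 1`; in the first derivative the boundary term was absent
since `k 0 = 0`. -/
theorem hasDerivAt_duhamel_deriv_impulseResponse (hf : ContDiff ℝ 1 f) (t : ℝ) :
    HasDerivAt (duhamel (deriv (impulseResponse c ω)) f)
      (f t - 2 * c * duhamel (deriv (impulseResponse c ω)) f t) t := by
  have h := hasDerivAt_duhamel
    (ContDiff.deriv' (contDiff_impulseResponse c ω 2 : ContDiff ℝ (1 + 1) _)) hf t
  rw [funext fun t => (hasDerivAt_deriv_impulseResponse c ω t).deriv, duhamel_const_mul,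
    deriv_impulseResponse_zero] at h
  exact h.congr_deriv (by ring)

/-- Differentiating `exp (-c t)` cancels the mass term `c² K φ` and the term `c K_t φ`. -/
theorem hasDerivAt_dampedWave_time (hf : ContDiff ℝ 1 f) (hφ : ContDiff ℝ 2 φ)
    (hψ : ContDiff ℝ 1 ψ) (t z : ℝ) :
    HasDerivAt (fun t => dampedWave c ω f φ ψ t z)
      (Real.exp (-c * t) * (ω ^ 2 * kleinGordon c ω (deriv (deriv φ)) t z +
        kleinGordonDeriv c ω ψ t z - c * kleinGordon c ω ψ t z) +
        duhamel (deriv (impulseResponse c ω)) f t) t := by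
  refine (((hasDerivAt_exp_neg_mul c t).mul
    (((hasDerivAt_kleinGordonDeriv_time hφ t z).add
      ((hasDerivAt_kleinGordon_time (hφ.of_le one_le_two) t z).const_mul c)).add
        (hasDerivAt_kleinGordon_time hψ t z))).add
          (hasDerivAt_duhamel_impulseResponse hf t)).congr_deriv ?_
  simp only [Pi.add_apply]
  ring

theorem hasDerivAt_deriv_dampedWave_time (hf : ContDiff ℝ 1 f) (hφ : ContDiff ℝ 3 φ)
    (hψ : ContDiff ℝ 2 ψ) (t z : ℝ) :
    HasDerivAt (deriv fun t => dampedWave c ω f φ ψ t z)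
      (ω ^ 2 * (Real.exp (-c * t) * (kleinGordonDeriv c ω (deriv (deriv φ)) t z +
        c * kleinGordon c ω (deriv (deriv φ)) t z + kleinGordon c ω (deriv (deriv ψ)) t z)) -
        2 * c * deriv (fun t => dampedWave c ω f φ ψ t z) t + f t) t := by
  have hφ2 : ContDiff ℝ 2 φ := hφ.of_le (by norm_num)
  have hφ' : ContDiff ℝ 2 (deriv φ) := ContDiff.deriv' (hφ : ContDiff ℝ (2 + 1) φ)
  have hφ'' : ContDiff ℝ 1 (deriv (deriv φ)) := ContDiff.deriv' hφ'
  have hψ1 : ContDiff ℝ 1 ψ := hψ.of_le one_le_two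
  rw [funext fun t => (hasDerivAt_dampedWave_time (c := c) (ω := ω) hf hφ2 hψ1 t z).deriv]
  refine (((hasDerivAt_exp_neg_mul c t).mul
    ((((hasDerivAt_kleinGordon_time hφ'' t z).const_mul (ω ^ 2)).add
      (hasDerivAt_kleinGordonDeriv_time hψ t z)).sub
        ((hasDerivAt_kleinGordon_time hψ1 t z).const_mul c))).add
          (hasDerivAt_duhamel_deriv_impulseResponse hf t)).congr_deriv ?_
  simp only [Pi.add_apply, Pi.sub_apply]
  ring

theorem hasDerivAt_dampedWave_space (hφ : ContDiff ℝ 2 φ) (hψ : ContDiff ℝ 1 ψ) (t z : ℝ) :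
    HasDerivAt (fun z => dampedWave c ω f φ ψ t z)
      (Real.exp (-c * t) * (kleinGordonDeriv c ω (deriv φ) t z +
        c * kleinGordon c ω (deriv φ) t z + kleinGordon c ω (deriv ψ) t z)) z :=
  ((((hasDerivAt_kleinGordonDeriv_space hφ t z).add
    ((hasDerivAt_kleinGordon_space (hφ.of_le one_le_two) t z).const_mul c)).add
      (hasDerivAt_kleinGordon_space hψ t z)).const_mul _).add_const _

theorem hasDerivAt_deriv_dampedWave_space (hφ : ContDiff ℝ 3 φ) (hψ : ContDiff ℝ 2 ψ) (t z : ℝ) :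
    HasDerivAt (deriv fun z => dampedWave c ω f φ ψ t z)
      (Real.exp (-c * t) * (kleinGordonDeriv c ω (deriv (deriv φ)) t z +
        c * kleinGordon c ω (deriv (deriv φ)) t z + kleinGordon c ω (deriv (deriv ψ)) t z)) z := by
  have hφ' : ContDiff ℝ 2 (deriv φ) := ContDiff.deriv' (hφ : ContDiff ℝ (2 + 1) φ)
  have hψ' : ContDiff ℝ 1 (deriv ψ) := ContDiff.deriv' hψ
  rw [funext fun z => (hasDerivAt_dampedWave_space (c := c) (ω := ω) (f := f)
    (hφ.of_le (by norm_num)) (hψ.of_le one_le_two) t z).deriv]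
  exact (((hasDerivAt_kleinGordonDeriv_space hφ' t z).add
    ((hasDerivAt_kleinGordon_space (hφ'.of_le one_le_two) t z).const_mul c)).add
      (hasDerivAt_kleinGordon_space hψ' t z)).const_mul _

theorem isClassicalSolution_dampedWave (hf : ContDiff ℝ 2 f) (hφ : ContDiff ℝ 3 φ)
    (hψ : ContDiff ℝ 2 ψ) :
    IsClassicalSolution ω (2 * c) f φ ψ (dampedWave c ω f φ ψ) where
  contDiffOn_open := (contDiff_dampedWave hf hφ hψ).contDiffOn
  contDiffOn_closed := ((contDiff_dampedWave hf hφ hψ).of_le one_le_two).contDiffOn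
  equation t _ z := by
    simp only [iteratedDeriv_succ, iteratedDeriv_zero]
    rw [(hasDerivAt_deriv_dampedWave_time (hf.of_le one_le_two) hφ hψ t z).deriv,
      (hasDerivAt_deriv_dampedWave_space hφ hψ t z).deriv]
  initial_position z := by
    simp [dampedWave, kleinGordon_zero, kleinGordonDeriv_zero, duhamel_zero]
  initial_velocity z := by
    refine (hasDerivAt_dampedWave_time (hf.of_le one_le_two) (hφ.of_le (by norm_num))
      (hψ.of_le one_le_two) 0 z).hasDerivWithinAt.congr_deriv ?_
    simp [kleinGordon_zero, kleinGordonDeriv_zero, duhamel_zero]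

end dampedWave

/-! ### Identification with the explicit formula. -/

theorem IsClassicalSolution.congr {ω α : ℝ} {f φ ψ : ℝ → ℝ} {g h : ℝ → ℝ → ℝ}
    (hg : IsClassicalSolution ω α f φ ψ g) (heq : ∀ t, 0 ≤ t → ∀ z, h t z = g t z) :
    IsClassicalSolution ω α f φ ψ h where
  contDiffOn_open := hg.contDiffOn_open.congr fun p hp => heq p.1 (le_of_lt hp.1) p.2
  contDiffOn_closed := hg.contDiffOn_closed.congr fun p hp => heq p.1 hp.1 p.2
  equation t ht z := by
    have h1 : (fun s => h s z) =ᶠ[𝓝 t] fun s => g s z := by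
      filter_upwards [Ioi_mem_nhds ht] with s hs using heq s (le_of_lt hs) z
    rw [h1.iteratedDeriv_eq, h1.deriv_eq, funext (heq t ht.le)]
    exact hg.equation t ht z
  initial_position z := (heq 0 le_rfl z).trans (hg.initial_position z)
  initial_velocity z := (hg.initial_velocity z).congr (fun t ht => heq t ht z) (heq 0 le_rfl z)

section explicitG

variable {α ω : ℝ} {f φ ψ : ℝ → ℝ}

theorem integral_cone (ω t z : ℝ) (h : ℝ → ℝ) :
    ∫ ξ in (z - ω * t)..(z + ω * t), h ξ =
      ω * t * ∫ y in (-1 : ℝ)..1, h (z + ω * t * y) := by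
  rw [intervalIntegral.mul_integral_comp_add_mul]
  ring_nf

theorem coneRoot_sq (hω : ω ≠ 0) (t z : ℝ) {y : ℝ} (hy : y ∈ Ioo (-1 : ℝ) 1) :
    coneRoot ω t z (z + ω * t * y) ^ 2 = t ^ 2 * (1 - y ^ 2) := by
  have h : t ^ 2 - (z - (z + ω * t * y)) ^ 2 / ω ^ 2 = t ^ 2 * (1 - y ^ 2) := by
    field_simp
    ring
  rw [coneRoot, h, Real.sq_sqrt]
  have : y ^ 2 ≤ 1 := by nlinarith [hy.1, hy.2]
  nlinarith [sq_nonneg t]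

theorem besselI0_coneRoot (hω : ω ≠ 0) (t z : ℝ) {y : ℝ} (hy : y ∈ Ioo (-1 : ℝ) 1) :
    besselI0 (α / 2 * coneRoot ω t z (z + ω * t * y)) =
      besselClifford 0 ((α / 2) ^ 2 / 4 * (t ^ 2 * (1 - y ^ 2))) := by
  rw [besselI0_eq_besselClifford, mul_pow, coneRoot_sq hω t z hy]
  ring_nf

/-- The open interval matters: at `y = ±1` the root is zero and the quotient takes the default value
`0` instead of its limit. These two points do not affect the integral. -/
theorem besselI1_coneRoot (hω : ω ≠ 0) (t z : ℝ) (ht : 0 < t) {y : ℝ}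
    (hy : y ∈ Ioo (-1 : ℝ) 1) :
    besselI1 (α / 2 * coneRoot ω t z (z + ω * t * y)) / coneRoot ω t z (z + ω * t * y) =
      α / 4 * besselClifford 1 ((α / 2) ^ 2 / 4 * (t ^ 2 * (1 - y ^ 2))) := by
  have hs := coneRoot_sq hω t z hy
  have hne : coneRoot ω t z (z + ω * t * y) ≠ 0 := by
    intro h
    have : 0 < 1 - y ^ 2 := by nlinarith [hy.1, hy.2]
    rw [h] at hs
    have : 0 < t ^ 2 * (1 - y ^ 2) := by positivity
    linarith
  rw [besselI1_eq_besselClifford, mul_pow, hs, div_eq_iff hne]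
  ring_nf

theorem integral_besselI0_coneRoot (hω : ω ≠ 0) (t z : ℝ) :
    ∫ ξ in (z - ω * t)..(z + ω * t), besselI0 (α / 2 * coneRoot ω t z ξ) * ψ ξ =
      2 * ω * kleinGordon (α / 2) ω ψ t z := by
  rw [integral_cone, kleinGordon, ← intervalIntegral.integral_const_mul,
    ← intervalIntegral.integral_const_mul]
  refine intervalIntegral.integral_congr_Ioo_of_le (by norm_num) fun y hy => ?_
  simp only [besselI0_coneRoot hω t z hy]
  ring

theorem kleinGordon_one_eq (c ω t z : ℝ) :
    kleinGordon c ω (fun _ => 1) t z = kleinGordon c ω (fun _ => 1) t 0 := rfl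

theorem explicitG_eq_dampedWave (hω : ω ≠ 0) (hφ : ContDiff ℝ 1 φ) {t : ℝ} (ht : 0 ≤ t) (z : ℝ) :
    explicitG ω α f φ ψ t z = dampedWave (α / 2) ω f φ ψ t z := by
  have h1c := continuous_besselClifford 1
  have h0c := continuous_besselClifford 0
  have hφc := hφ.continuous
  have hforce : 1 / (2 * ω) *
      (∫ τ in (0 : ℝ)..t, Real.exp (-(α / 2) * (t - τ)) * f τ *
        (∫ ξ in (z - ω * (t - τ))..(z + ω * (t - τ)),
          besselI0 (α / 2 * coneRoot ω (t - τ) z ξ))) =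
      duhamel (impulseResponse (α / 2) ω) f t := by
    rw [duhamel_eq_integral, ← intervalIntegral.integral_const_mul]
    refine intervalIntegral.integral_congr fun τ _ => ?_
    have h := integral_besselI0_coneRoot (α := α) (ψ := fun _ => 1) hω (t - τ) z
    simp only [mul_one] at h
    simp only [h, impulseResponse, kleinGordon_one_eq _ _ _ z]
    field_simp
  have hpos : α / (4 * ω) *
      (∫ ξ in (z - ω * t)..(z + ω * t),
        (t * (besselI1 (α / 2 * coneRoot ω t z ξ) / coneRoot ω t z ξ)
          + besselI0 (α / 2 * coneRoot ω t z ξ)) * φ ξ) =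
      (∫ y in (-1 : ℝ)..1, t ^ 2 * ((α / 2) ^ 2 / 4) *
        besselClifford 1 ((α / 2) ^ 2 / 4 * (t ^ 2 * (1 - y ^ 2))) * φ (z + ω * t * y)) +
      α / 2 * kleinGordon (α / 2) ω φ t z := by
    -- At `t = 0` the root vanishes identically and the quotient formula is unavailable, but both
    -- sides are zero.
    rcases ht.eq_or_lt with rfl | ht
    · simp [kleinGordon_zero]
    rw [integral_cone, kleinGordon, ← intervalIntegral.integral_const_mul,
      ← intervalIntegral.integral_const_mul, ← intervalIntegral.integral_const_mul,
      ← intervalIntegral.integral_add]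
    · refine intervalIntegral.integral_congr_Ioo_of_le (by norm_num) fun y hy => ?_
      simp only [besselI0_coneRoot hω t z hy, besselI1_coneRoot hω t z ht hy]
      field_simp
      ring
    all_goals exact Continuous.intervalIntegrable (by fun_prop) _ _
  have hvel : Real.exp (-(α / 2) * t) / (2 * ω) * (2 * ω * kleinGordon (α / 2) ω ψ t z) =
      Real.exp (-(α / 2) * t) * kleinGordon (α / 2) ω ψ t z := by
    field_simp
  rw [explicitG, dampedWave, hforce, integral_besselI0_coneRoot hω, hvel, kleinGordonDeriv_eq hφ]
  linear_combination Real.exp (-(α / 2) * t) * hpos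

theorem isClassicalSolution_explicitG (hω : ω ≠ 0) (hf : ContDiff ℝ 2 f) (hφ : ContDiff ℝ 3 φ)
    (hψ : ContDiff ℝ 2 ψ) : IsClassicalSolution ω α f φ ψ (explicitG ω α f φ ψ) := by
  have h := isClassicalSolution_dampedWave (c := α / 2) (ω := ω) hf hφ hψ
  rw [mul_div_cancel₀ α two_ne_zero] at h
  exact h.congr fun t ht z => explicitG_eq_dampedWave hω (hφ.of_le (by norm_num)) ht z

end explicitG

/-! ### Uniqueness by characteristics. -/

section uniqueness

variable {ω α : ℝ} {f₁ f₂ φ₁ φ₂ ψ₁ ψ₂ : ℝ → ℝ} {g₁ g₂ g : ℝ → ℝ → ℝ}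

theorem IsClassicalSolution.contDiffAt {f φ ψ : ℝ → ℝ} (h : IsClassicalSolution ω α f φ ψ g)
    {p : ℝ × ℝ} (hp : 0 < p.1) : ContDiffAt ℝ 2 (Function.uncurry g) p :=
  h.contDiffOn_open.contDiffAt ((isOpen_Ioi.prod isOpen_univ).mem_nhds ⟨hp, mem_univ _⟩)

theorem IsClassicalSolution.contDiffAt_time {f φ ψ : ℝ → ℝ}
    (h : IsClassicalSolution ω α f φ ψ g) {t : ℝ} (ht : 0 < t) (z : ℝ) :
    ContDiffAt ℝ 2 (fun s => g s z) t :=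
  ContDiffAt.comp (g := Function.uncurry g) (f := fun s : ℝ => (s, z)) t
    (h.contDiffAt (p := (t, z)) ht) (contDiffAt_id.prodMk contDiffAt_const)

theorem IsClassicalSolution.contDiffAt_space {f φ ψ : ℝ → ℝ}
    (h : IsClassicalSolution ω α f φ ψ g) {t : ℝ} (ht : 0 < t) (z : ℝ) :
    ContDiffAt ℝ 2 (fun y => g t y) z :=
  ContDiffAt.comp (g := Function.uncurry g) (f := fun y : ℝ => (t, y)) z
    (h.contDiffAt (p := (t, z)) ht) (contDiffAt_const.prodMk contDiffAt_id)

theorem IsClassicalSolution.sub (h₁ : IsClassicalSolution ω α f₁ φ₁ ψ₁ g₁)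
    (h₂ : IsClassicalSolution ω α f₂ φ₂ ψ₂ g₂) :
    IsClassicalSolution ω α (f₁ - f₂) (φ₁ - φ₂) (ψ₁ - ψ₂) (g₁ - g₂) where
  contDiffOn_open := h₁.contDiffOn_open.sub h₂.contDiffOn_open
  contDiffOn_closed := h₁.contDiffOn_closed.sub h₂.contDiffOn_closed
  equation t ht z := by
    have e₁ := iteratedDeriv_sub (h₁.contDiffAt_time ht z) (h₂.contDiffAt_time ht z)
    have e₂ := iteratedDeriv_sub (h₁.contDiffAt_space ht z) (h₂.contDiffAt_space ht z)
    have e₃ := deriv_sub ((h₁.contDiffAt_time ht z).differentiableAt two_ne_zero)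
      ((h₂.contDiffAt_time ht z).differentiableAt two_ne_zero)
    have d₁ := h₁.equation t ht z
    have d₂ := h₂.equation t ht z
    change iteratedDeriv 2 ((fun s => g₁ s z) - fun s => g₂ s z) t =
      ω ^ 2 * iteratedDeriv 2 ((fun y => g₁ t y) - fun y => g₂ t y) z -
        α * deriv ((fun s => g₁ s z) - fun s => g₂ s z) t + (f₁ t - f₂ t)
    rw [e₁, e₂, e₃, d₁, d₂]
    ring
  initial_position z := congrArg₂ (· - ·) (h₁.initial_position z) (h₂.initial_position z)
  initial_velocity z := (h₁.initial_velocity z).sub (h₂.initial_velocity z)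

theorem ContDiffAt.hasDerivAt_fderiv_comp {F : ℝ × ℝ → ℝ} {γ : ℝ → ℝ × ℝ} {v : ℝ × ℝ} {s : ℝ}
    (hF : ContDiffAt ℝ 2 F (γ s)) (hγ : HasDerivAt γ v s) (u : ℝ × ℝ) :
    HasDerivAt (fun s => fderiv ℝ F (γ s) u) (fderiv ℝ (fderiv ℝ F) (γ s) v u) s := by
  have h1 : DifferentiableAt ℝ (fderiv ℝ F) (γ s) :=
    (hF.fderiv_right (m := 1) (by norm_num)).differentiableAt one_ne_zero
  have h2 := h1.hasFDerivAt.comp_hasDerivAt s hγ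
  exact (HasDerivAt.clm_apply h2 (hasDerivAt_const s u)).congr_deriv (by simp)

theorem ContDiffAt.iteratedDeriv_two_comp {F : ℝ × ℝ → ℝ} {γ : ℝ → ℝ × ℝ} {v : ℝ × ℝ} {s : ℝ}
    (hF : ContDiffAt ℝ 2 F (γ s)) (hγ : ∀ s, HasDerivAt γ v s) :
    iteratedDeriv 2 (fun s => F (γ s)) s = fderiv ℝ (fderiv ℝ F) (γ s) v v := by
  have h : deriv (fun s => F (γ s)) =ᶠ[𝓝 s] fun s => fderiv ℝ F (γ s) v := by
    filter_upwards [(hγ s).continuousAt.eventually (hF.eventually (by simp))] with x hx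
    exact ((hx.differentiableAt two_ne_zero).hasFDerivAt.comp_hasDerivAt x (hγ x)).deriv
  simp only [iteratedDeriv_succ, iteratedDeriv_zero]
  rw [h.deriv_eq, (hF.hasDerivAt_fderiv_comp (hγ s) v).deriv]

/-- The wave operator factors as `(∂_t - l ∂_z)(∂_t + l ∂_z)` for `l = ±ω`, by symmetry of the
second derivative; the damping is the right-hand side. -/
theorem IsClassicalSolution.hasDerivAt_characteristic (h : IsClassicalSolution ω α 0 0 0 g)
    {l : ℝ} (hl : l ^ 2 = ω ^ 2) (y : ℝ) {s : ℝ} (hs : 0 < s) :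
    HasDerivAt (fun s => fderiv ℝ (Function.uncurry g) (s, y - l * s) (1, l))
      (-α * fderiv ℝ (Function.uncurry g) (s, y - l * s) (1, 0)) s := by
  set p : ℝ × ℝ := (s, y - l * s) with hp
  have hF := h.contDiffAt (p := p) hs
  have hγ : HasDerivAt (fun s : ℝ => (s, y - l * s)) ((1 : ℝ), -l) s :=
    (hasDerivAt_id' s).prodMk ((((hasDerivAt_id' s).const_mul l).const_sub y).congr_deriv (by ring))
  refine (ContDiffAt.hasDerivAt_fderiv_comp (γ := fun s : ℝ => (s, y - l * s)) hF hγ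
    (1, l)).congr_deriv ?_
  have ht (x : ℝ) : HasDerivAt (fun s : ℝ => (s, y - l * p.1)) ((1 : ℝ), (0 : ℝ)) x :=
    (hasDerivAt_id' x).prodMk (hasDerivAt_const _ _)
  have hz (x : ℝ) : HasDerivAt (fun z : ℝ => (s, z)) ((0 : ℝ), (1 : ℝ)) x :=
    (hasDerivAt_const _ _).prodMk (hasDerivAt_id' x)
  have e₁ := ContDiffAt.iteratedDeriv_two_comp (s := s) hF ht
  have e₂ := ContDiffAt.iteratedDeriv_two_comp (s := y - l * s) hF hz
  have e₃ := ((hF.differentiableAt two_ne_zero).hasFDerivAt.comp_hasDerivAt s (ht s)).deriv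
  have heq := h.equation s hs (y - l * s)
  have hsymm : IsSymmSndFDerivAt ℝ (Function.uncurry g) p := hF.isSymmSndFDerivAt (by simp)
  have hsy := hsymm (1, 0) (0, 1)
  have d₁ : ((1 : ℝ), -l) = (1, 0) + (-l) • ((0 : ℝ), (1 : ℝ)) := by simp
  have d₂ : ((1 : ℝ), l) = (1, 0) + l • ((0 : ℝ), (1 : ℝ)) := by simp
  simp only [Function.comp_def, Function.uncurry] at e₁ e₂ e₃
  rw [e₁, e₂, e₃] at heq
  change fderiv ℝ (fderiv ℝ (Function.uncurry g)) p (1, -l) (1, l) = _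
  rw [d₁, d₂]
  simp only [map_add, map_smul, add_apply, smul_apply,
    smul_eq_mul]
  change fderiv ℝ (fderiv ℝ (Function.uncurry g)) p (1, 0) (1, 0) =
    ω ^ 2 * fderiv ℝ (fderiv ℝ (Function.uncurry g)) p (0, 1) (0, 1) -
      α * fderiv ℝ (Function.uncurry g) p (1, 0) + 0 at heq
  rw [← hl] at heq
  linear_combination heq + l * hsy

theorem IsClassicalSolution.eq_zero (hω : 0 < ω) (h : IsClassicalSolution ω α 0 0 0 g) {T : ℝ}
    (hT : 0 ≤ T) (z : ℝ) : g T z = 0 := by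
  set S : Set (ℝ × ℝ) := Ici 0 ×ˢ univ with hS
  -- The derivative within the closed half-plane is continuous up to `t = 0`, where the initial data
  -- enter; for `t > 0` it is the ordinary one.
  set D : ℝ × ℝ → ℝ × ℝ →L[ℝ] ℝ := fderivWithin ℝ (Function.uncurry g) S with hD
  have hSu : UniqueDiffOn ℝ S := (uniqueDiffOn_Ici 0).prod uniqueDiffOn_univ
  have hDc : ContinuousOn D S := h.contDiffOn_closed.continuousOn_fderivWithin hSu le_rfl
  have hDd (p : ℝ × ℝ) (hp : p ∈ S) : HasFDerivWithinAt (Function.uncurry g) (D p) S p :=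
    (h.contDiffOn_closed.differentiableOn one_ne_zero p hp).hasFDerivWithinAt
  have hDi (p : ℝ × ℝ) (hp : 0 < p.1) : D p = fderiv ℝ (Function.uncurry g) p :=
    fderivWithin_of_mem_nhds (prod_mem_nhds (Ici_mem_nhds hp) univ_mem)
  have hDt (t y : ℝ) (ht : 0 ≤ t) :
      HasDerivWithinAt (fun s => g s y) (D (t, y) (1, 0)) (Ici 0) t :=
    HasFDerivWithinAt.comp_hasDerivWithinAt (l := Function.uncurry g) (f := fun s : ℝ => (s, y)) t
      (hDd (t, y) ⟨ht, mem_univ _⟩)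
      ((hasDerivAt_id' t).prodMk (hasDerivAt_const _ _)).hasDerivWithinAt
      (fun s hs => ⟨hs, mem_univ _⟩)
  have hD0t (y : ℝ) : D (0, y) (1, 0) = 0 :=
    (uniqueDiffOn_Ici (0 : ℝ) 0 self_mem_Ici).eq_deriv _ (hDt 0 y le_rfl) (h.initial_velocity y)
  have hD0z (y : ℝ) : D (0, y) (0, 1) = 0 := by
    have e : HasDerivWithinAt (fun z => g 0 z) (D (0, y) (0, 1)) univ y :=
      HasFDerivWithinAt.comp_hasDerivWithinAt (l := Function.uncurry g)
        (f := fun z : ℝ => ((0 : ℝ), z)) y (hDd (0, y) ⟨self_mem_Ici, mem_univ _⟩)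
        ((hasDerivAt_const _ _).prodMk (hasDerivAt_id' y)).hasDerivWithinAt
        (fun z _ => ⟨self_mem_Ici, mem_univ _⟩)
    have e' : (fun z => g 0 z) = fun _ => 0 := funext h.initial_position
    rw [e', hasDerivWithinAt_univ] at e
    exact e.unique (hasDerivAt_const _ _)
  have hD0 (y l : ℝ) : D (0, y) (1, l) = 0 := by
    have d : ((1 : ℝ), l) = (1, 0) + l • ((0 : ℝ), (1 : ℝ)) := by simp
    rw [d, map_add, map_smul, hD0t, hD0z, smul_zero, add_zero]
  have hsplit (p : ℝ × ℝ) : D p (1, 0) = (D p (1, ω) + D p (1, -ω)) / 2 := by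
    have d : ((1 : ℝ), (0 : ℝ)) = (1 / 2 : ℝ) • ((1, ω) + (1, -ω)) := by
      ext <;> simp; norm_num
    rw [d, map_smul, map_add, smul_eq_mul]
    ring
  -- The backward cone with apex `(T, z)`: it is compact, and characteristics followed back in time
  -- do not leave it.
  set K : Set (ℝ × ℝ) := {p | 0 ≤ p.1 ∧ p.1 ≤ T ∧ |p.2 - z| ≤ ω * (T - p.1)} with hK
  have hKS : K ⊆ S := fun p hp => ⟨hp.1, mem_univ _⟩
  have hKc : IsCompact K := by
    refine ((isCompact_Icc (a := (0 : ℝ)) (b := T)).prod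
      (isCompact_Icc (a := z - ω * T) (b := z + ω * T))).of_isClosed_subset ?_ fun p hp => ?_
    · exact (isClosed_le continuous_const continuous_fst).inter
        ((isClosed_le continuous_fst continuous_const).inter
          (isClosed_le (f := fun p : ℝ × ℝ => |p.2 - z|) (g := fun p => ω * (T - p.1))
            (by fun_prop) (by fun_prop)))
    · obtain ⟨h0, h1, h2⟩ := hp
      have := mul_nonneg hω.le h0
      rw [abs_le] at h2
      exact ⟨⟨h0, h1⟩, by constructor <;> nlinarith⟩
  obtain ⟨C, hC⟩ := hKc.exists_bound_of_continuousOn (hDc.mono hKS)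
  have hl (l : ℝ) (hl : l ^ 2 = ω ^ 2) : |l| = ω := by
    rw [← Real.sqrt_sq_eq_abs, hl, Real.sqrt_sq hω.le]
  -- Picard iteration: the time derivative is the mean of the two characteristic derivatives, so the
  -- bound at stage `n` integrates along a characteristic, from the value `0` at time `0`, to the
  -- one at stage `n + 1`.
  have hbound (n : ℕ) : ∀ p ∈ K, ∀ l, l ^ 2 = ω ^ 2 →
      |D p (1, l)| ≤ C * ‖((1 : ℝ), ω)‖ * ((|α| * p.1) ^ n / (n.factorial : ℝ)) := by
    induction n with
    | zero =>
      intro p hp l hlω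
      have hnorm : ‖((1 : ℝ), l)‖ = ‖((1 : ℝ), ω)‖ := by
        simp [Prod.norm_def, hl l hlω, abs_of_pos hω]
      have := (D p).le_of_opNorm_le (hC p hp) (1, l)
      rw [hnorm] at this
      simpa using this
    | succ n ih =>
      rintro ⟨t, y⟩ hp l hlω
      obtain ⟨ht0, htT, hty⟩ := hp
      simp only at ht0 htT hty ⊢
      set M : ℝ := C * ‖((1 : ℝ), ω)‖ with hM
      have hmem (s : ℝ) (hs : s ∈ Icc 0 t) : (s, y + l * t - l * s) ∈ K := by
        refine ⟨hs.1, hs.2.trans htT, ?_⟩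
        calc |y + l * t - l * s - z| = |(y - z) + l * (t - s)| := by ring_nf
          _ ≤ |y - z| + |l * (t - s)| := abs_add_le _ _
          _ ≤ ω * (T - t) + ω * (t - s) := by
            rw [abs_mul, hl l hlω, abs_of_nonneg (sub_nonneg.2 hs.2)]
            linarith
          _ = ω * (T - s) := by ring
      set a : ℝ → ℝ := fun s => D (s, y + l * t - l * s) (1, l) with ha
      set b : ℝ → ℝ := fun s => M * ((|α| * s) ^ (n + 1) / ((n + 1).factorial : ℝ)) with hb
      have hac : ContinuousOn a (Icc 0 t) := by
        have : ContinuousOn (fun s => D (s, y + l * t - l * s)) (Icc 0 t) :=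
          hDc.comp (f := fun s => (s, y + l * t - l * s))
            (Continuous.continuousOn (by fun_prop)) fun s hs => hKS (hmem s hs)
        exact this.clm_apply continuousOn_const
      have hbc : ContinuousOn b (Icc 0 t) := Continuous.continuousOn (by fun_prop)
      have had (s : ℝ) (hs : s ∈ Ioo 0 t) :
          HasDerivAt a (-α * D (s, y + l * t - l * s) (1, 0)) s := by
        have h1 := h.hasDerivAt_characteristic hlω (y + l * t) hs.1
        rw [hDi (s, y + l * t - l * s) hs.1]
        refine h1.congr_of_eventuallyEq ?_
        filter_upwards [Ioi_mem_nhds hs.1] with x hx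
        rw [ha, ← hDi (x, y + l * t - l * x) hx]
      have hbd (s : ℝ) : HasDerivAt b (|α| * (M * ((|α| * s) ^ n / (n.factorial : ℝ)))) s := by
        refine ((((((hasDerivAt_id' s).const_mul |α|).pow (n + 1)).div_const
          ((n + 1).factorial : ℝ)).const_mul M)).congr_deriv ?_
        have : (n.factorial : ℝ) ≠ 0 := by positivity
        rw [Nat.factorial_succ]
        push_cast
        field_simp
      have hle (s : ℝ) (hs : s ∈ Ioo 0 t) : |-α * D (s, y + l * t - l * s) (1, 0)| ≤
          |α| * (M * ((|α| * s) ^ n / (n.factorial : ℝ))) := by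
        have hk := hmem s (Ioo_subset_Icc_self hs)
        have i1 := ih _ hk ω rfl
        have i2 := ih _ hk (-ω) (neg_sq ω)
        rw [abs_mul, abs_neg, hsplit, abs_div, abs_two]
        gcongr
        have := abs_add_le (D (s, y + l * t - l * s) (1, ω)) (D (s, y + l * t - l * s) (1, -ω))
        linarith
      -- Since `|a'| ≤ b'` and both functions vanish at `0`, monotonicity of `b - a` and `b + a`
      -- gives `|a t| ≤ b t`.
      have hmono : MonotoneOn (fun s => b s - a s) (Icc 0 t) := by
        refine monotoneOn_of_deriv_nonneg (convex_Icc 0 t) (hbc.sub hac) ?_ ?_ <;>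
          rw [interior_Icc]
        · exact fun s hs => ((hbd s).sub (had s hs)).differentiableAt.differentiableWithinAt
        · intro s hs
          have hd : HasDerivAt (fun s => b s - a s) _ s := (hbd s).sub (had s hs)
          rw [hd.deriv]
          linarith [(abs_le.1 (hle s hs)).2]
      have hmono' : MonotoneOn (fun s => b s + a s) (Icc 0 t) := by
        refine monotoneOn_of_deriv_nonneg (convex_Icc 0 t) (hbc.add hac) ?_ ?_ <;>
          rw [interior_Icc]
        · exact fun s hs => ((hbd s).add (had s hs)).differentiableAt.differentiableWithinAt
        · intro s hs
          have hd : HasDerivAt (fun s => b s + a s) _ s := (hbd s).add (had s hs)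
          rw [hd.deriv]
          linarith [(abs_le.1 (hle s hs)).1]
      have m1 := hmono (left_mem_Icc.2 ht0) (right_mem_Icc.2 ht0) ht0
      have m2 := hmono' (left_mem_Icc.2 ht0) (right_mem_Icc.2 ht0) ht0
      have a0 : a 0 = 0 := hD0 _ _
      have b0 : b 0 = 0 := by simp [hb]
      have a_end : a t = D (t, y) (1, l) := by simp [ha]
      simp only [a0, b0, a_end] at m1 m2
      rw [abs_le]
      constructor <;> linarith
  have hzero (p : ℝ × ℝ) (hp : p ∈ K) (l : ℝ) (hlω : l ^ 2 = ω ^ 2) : D p (1, l) = 0 := by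
    have hlim := (FloorSemiring.tendsto_pow_div_factorial_atTop (|α| * p.1)).const_mul
      (C * ‖((1 : ℝ), ω)‖)
    rw [mul_zero] at hlim
    exact abs_nonpos_iff.1 (ge_of_tendsto' hlim fun n => hbound n p hp l hlω)
  have hconst := constant_of_has_deriv_right_zero (f := fun s => g s z) (a := 0) (b := T)
    (fun s hs => (hDt s z hs.1).continuousWithinAt.mono Icc_subset_Ici_self) (fun s hs => by
      have hk : (s, z) ∈ K :=
        ⟨hs.1, hs.2.le, by simpa using mul_nonneg hω.le (sub_nonneg.2 hs.2.le)⟩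
      have e := hDt s z hs.1
      rw [hsplit, hzero _ hk ω rfl, hzero _ hk (-ω) (neg_sq ω), add_zero, zero_div] at e
      exact e.mono (Ici_subset_Ici.2 hs.1))
  exact (hconst T (right_mem_Icc.2 hT)).trans (h.initial_position z)

theorem IsClassicalSolution.unique {f φ ψ : ℝ → ℝ} (hω : 0 < ω)
    (h₁ : IsClassicalSolution ω α f φ ψ g₁) (h₂ : IsClassicalSolution ω α f φ ψ g₂) {t : ℝ}
    (ht : 0 ≤ t) (z : ℝ) : g₁ t z = g₂ t z := by
  have h := h₁.sub h₂
  rw [sub_self, sub_self, sub_self] at h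
  exact sub_eq_zero.1 (h.eq_zero hω ht z)

end uniqueness

/-! ### Growth over a period and the diffeomorphism. -/

section diffeomorphism

variable {c ω : ℝ} {f φ ψ : ℝ → ℝ}

/-- The integrated form keeps all `n` derivatives of `φ`, whereas the definition, containing `deriv
φ`, would give only `n - 1`. This yields class `C⁵`. -/
theorem contDiff_kleinGordonDeriv_space {n : ℕ} (hn : n ≠ 0) (hφ : ContDiff ℝ n φ) (t : ℝ) :
    ContDiff ℝ n fun z => kleinGordonDeriv c ω φ t z := by
  have hφ1 : ContDiff ℝ 1 φ := hφ.of_le (by exact_mod_cast Nat.one_le_iff_ne_zero.2 hn)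
  rw [funext fun z => kleinGordonDeriv_eq (c := c) (ω := ω) hφ1 t z]
  have h1 : ContDiff ℝ n fun z => ∫ y in (-1 : ℝ)..1, t ^ 2 * (c ^ 2 / 4) *
      besselClifford 1 (c ^ 2 / 4 * (t ^ 2 * (1 - y ^ 2))) * φ (z + ω * t * y) := by
    refine contDiff_intervalIntegral (F := fun z y => t ^ 2 * (c ^ 2 / 4) *
      besselClifford 1 (c ^ 2 / 4 * (t ^ 2 * (1 - y ^ 2))) * φ (z + ω * t * y)) ?_
    have h0 := contDiff_besselClifford n 1
    unfold Function.uncurry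
    fun_prop
  fun_prop

theorem contDiff_dampedWave_space {n : ℕ} (hn : n ≠ 0) (hφ : ContDiff ℝ n φ)
    (hψ : ContDiff ℝ n ψ) (t : ℝ) : ContDiff ℝ n fun z => dampedWave c ω f φ ψ t z := by
  have slice {χ : ℝ → ℝ} (hχ : ContDiff ℝ n χ) : ContDiff ℝ n fun z => kleinGordon c ω χ t z :=
    (contDiff_kleinGordon hχ).comp (f := fun z : ℝ => (t, z)) (contDiff_const.prodMk contDiff_id)
  have h1 := slice hφ
  have h2 := slice hψ
  have h3 := contDiff_kleinGordonDeriv_space (c := c) (ω := ω) hn hφ t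
  unfold dampedWave
  fun_prop

theorem kleinGordon_add_period {L a : ℝ} (hφc : Continuous φ) (hφ : ∀ z, φ (z + L) = φ z + a)
    (t z : ℝ) : kleinGordon c ω φ t (z + L) =
      kleinGordon c ω φ t z + a * kleinGordon c ω (fun _ => 1) t 0 := by
  have h0 := continuous_besselClifford 0
  rw [kleinGordon, kleinGordon, kleinGordon, ← intervalIntegral.integral_const_mul,
    ← intervalIntegral.integral_add]
  · refine intervalIntegral.integral_congr fun y _ => ?_
    simp only [add_right_comm z L, hφ]
    ring
  all_goals exact Continuous.intervalIntegrable (by fun_prop) _ _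

theorem kleinGordonDeriv_add_period {L a : ℝ} (hφc : ContDiff ℝ 1 φ)
    (hφ : ∀ z, φ (z + L) = φ z + a) (t z : ℝ) : kleinGordonDeriv c ω φ t (z + L) =
      kleinGordonDeriv c ω φ t z + a * kleinGordonDeriv c ω (fun _ => 1) t 0 := by
  have h0 := continuous_besselClifford 1
  have h1 := hφc.continuous
  have h2 : ∫ y in (-1 : ℝ)..1, t ^ 2 * (c ^ 2 / 4) *
      besselClifford 1 (c ^ 2 / 4 * (t ^ 2 * (1 - y ^ 2))) * φ (z + L + ω * t * y) =
      (∫ y in (-1 : ℝ)..1, t ^ 2 * (c ^ 2 / 4) *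
        besselClifford 1 (c ^ 2 / 4 * (t ^ 2 * (1 - y ^ 2))) * φ (z + ω * t * y)) +
      a * ∫ y in (-1 : ℝ)..1, t ^ 2 * (c ^ 2 / 4) *
        besselClifford 1 (c ^ 2 / 4 * (t ^ 2 * (1 - y ^ 2))) * 1 := by
    rw [← intervalIntegral.integral_const_mul, ← intervalIntegral.integral_add]
    · refine intervalIntegral.integral_congr fun y _ => ?_
      simp only [add_right_comm z L, hφ]
      ring
    all_goals exact Continuous.intervalIntegrable (by fun_prop) _ _
  rw [kleinGordonDeriv_eq hφc, kleinGordonDeriv_eq hφc, kleinGordonDeriv_eq contDiff_const, h2,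
    add_right_comm z L, hφ, add_sub_right_comm z L, hφ]
  ring

theorem kleinGordon_one_nonneg {t : ℝ} (ht : 0 ≤ t) (z : ℝ) :
    0 ≤ kleinGordon c ω (fun _ => 1) t z := by
  refine intervalIntegral.integral_nonneg (by norm_num) fun y hy => ?_
  have hy2 : 0 ≤ 1 - y ^ 2 := by nlinarith [hy.1, hy.2]
  have := besselClifford_nonneg 0 (x := c ^ 2 / 4 * (t ^ 2 * (1 - y ^ 2))) (by positivity)
  positivity

theorem kleinGordonDeriv_one_pos (t z : ℝ) : 0 < kleinGordonDeriv c ω (fun _ => 1) t z := by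
  rw [kleinGordonDeriv_eq contDiff_const]
  refine add_pos_of_pos_of_nonneg (by norm_num)
    (intervalIntegral.integral_nonneg (by norm_num) fun y hy => ?_)
  have hy2 : 0 ≤ 1 - y ^ 2 := by nlinarith [hy.1, hy.2]
  have := besselClifford_nonneg 1 (x := c ^ 2 / 4 * (t ^ 2 * (1 - y ^ 2))) (by positivity)
  positivity

/-- By linearity the increment is the unforced response to the constant position `L` and zero
velocity. It is positive because the Bessel–Clifford series have positive coefficients and `c ≥ 0`;
the Duhamel term cancels, being independent of `z`. -/
theorem exists_dampedWave_add_period {L : ℝ} (hL : 0 < L) (hc : 0 ≤ c) (hφc : ContDiff ℝ 1 φ)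
    (hψc : Continuous ψ) (hφ : ∀ z, φ (z + L) = φ z + L) (hψ : ∀ z, ψ (z + L) = ψ z)
    {t : ℝ} (ht : 0 ≤ t) :
    ∃ d > 0, ∀ z, dampedWave c ω f φ ψ t (z + L) = dampedWave c ω f φ ψ t z + d := by
  have h1 := kleinGordon_one_nonneg (c := c) (ω := ω) ht 0
  have h2 := kleinGordonDeriv_one_pos (c := c) (ω := ω) t 0
  refine ⟨Real.exp (-c * t) * (L * kleinGordonDeriv c ω (fun _ => 1) t 0 +
    c * (L * kleinGordon c ω (fun _ => 1) t 0)), by positivity, fun z => ?_⟩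
  have hψ' := kleinGordon_add_period (c := c) (ω := ω) (L := L) (a := 0) hψc (by simpa using hψ) t z
  rw [dampedWave, kleinGordonDeriv_add_period hφc hφ, kleinGordon_add_period hφc.continuous hφ,
    hψ', dampedWave]
  ring

/-- Iterating the shift makes `h` unbounded in both directions, and continuity does the rest. -/
theorem surjective_of_add_period {h : ℝ → ℝ} {L d : ℝ} (hc : Continuous h) (hm : Monotone h)
    (hd : 0 < d) (hper : ∀ z, h (z + L) = h z + d) : Function.Surjective h := by
  have hnat (n : ℕ) (z : ℝ) : h (z + n * L) = h z + n * d := by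
    induction n with
    | zero => simp
    | succ n ih =>
      push_cast
      rw [add_one_mul, ← add_assoc, hper, ih]
      ring
  refine hc.surjective (tendsto_atTop_atTop_of_monotone hm fun b => ?_)
    (tendsto_atBot_atBot_of_monotone hm fun b => ?_)
  · obtain ⟨n, hn⟩ := exists_nat_ge ((b - h 0) / d)
    refine ⟨0 + n * L, ?_⟩
    rw [hnat]
    linarith [(div_le_iff₀ hd).1 hn]
  · obtain ⟨n, hn⟩ := exists_nat_ge ((h 0 - b) / d)
    refine ⟨-(n * L), ?_⟩
    have := hnat n (-(n * L))
    rw [neg_add_cancel] at this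
    linarith [(div_le_iff₀ hd).1 hn]

theorem exists_diffeomorph_of_deriv_pos {h : ℝ → ℝ} {n : WithTop ℕ∞} (hn : n ≠ 0)
    (hh : ContDiff ℝ n h) (hpos : ∀ z, 0 < deriv h z) (hs : Function.Surjective h) :
    ∃ e : ℝ ≃ₘ^n⟮𝓘(ℝ, ℝ), 𝓘(ℝ, ℝ)⟯ ℝ, ∀ z : ℝ, e z = h z := by
  let o : ℝ ≃ₜ ℝ :=
    (StrictMono.orderIsoOfSurjective h (strictMono_of_deriv_pos hpos) hs).toHomeomorph
  have ho : ContDiff ℝ n o.symm := o.contDiff_symm_deriv (f' := deriv h) (fun z => (hpos z).ne')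
    (hh.hasDerivAt_of_ne_zero hn) hh
  exact ⟨⟨o.toEquiv, hh.contMDiff, ho.contMDiff⟩, fun z => rfl⟩

theorem contDiff_integral_succ {X : ℝ → ℝ} {n : ℕ} (hX : ContDiff ℝ n X) :
    ContDiff ℝ (n + 1) fun z => ∫ u in (0 : ℝ)..z, X u := by
  have hd (z : ℝ) : HasDerivAt (fun z => ∫ u in (0 : ℝ)..z, X u) (X z) z :=
    hX.continuous.integral_hasStrictDerivAt 0 z |>.hasDerivAt
  refine contDiff_succ_iff_deriv.2 ⟨fun z => (hd z).differentiableAt, by simp, ?_⟩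
  rwa [funext fun z => (hd z).deriv]

theorem integral_add_period {X : ℝ → ℝ} {L : ℝ} (hXc : Continuous X)
    (hX : Function.Periodic X L) (z : ℝ) :
    ∫ u in (0 : ℝ)..(z + L), X u = (∫ u in (0 : ℝ)..z, X u) + ∫ u in (0 : ℝ)..L, X u := by
  rw [hX.intervalIntegral_add_eq_add 0 z fun _ _ => hXc.intervalIntegrable _ _, zero_add]

end diffeomorphism

theorem mainTheorem10 (L ω₀ α v : ℝ) (hL : 0 < L) (hω₀ : 0 < ω₀) (hα : 0 ≤ α)
    (f X V : ℝ → ℝ) (hf : ContDiff ℝ 2 f)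
    (hX : ContDiff ℝ 4 X) (hXper : Function.Periodic X L) (hXpos : ∀ x, 0 < X x)
    (hXint : ∫ u in (0 : ℝ)..L, X u = L)
    (hV : ContDiff ℝ 4 V) (hVper : Function.Periodic V L)
    (hVint : ∫ u in (0 : ℝ)..L, V u = 0)
    (ω₁ : ℝ) (hω₁ : ω₁ = ω₀ * L)
    (φ : ℝ → ℝ) (hφ : ∀ z, φ z = ∫ u in (0 : ℝ)..z, X u)
    (ψ : ℝ → ℝ) (hψ : ∀ z, ψ z = v + ∫ u in (0 : ℝ)..z, V u) :
    (IsClassicalSolution ω₁ α f φ ψ (explicitG ω₁ α f φ ψ) ∧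
      ∀ g : ℝ → ℝ → ℝ, IsClassicalSolution ω₁ α f φ ψ g →
        ∀ t : ℝ, 0 ≤ t → ∀ z : ℝ, g t z = explicitG ω₁ α f φ ψ t z) ∧
    ∀ t : ℝ, 0 ≤ t → (∀ z : ℝ, 0 < deriv (fun y => explicitG ω₁ α f φ ψ t y) z) →
      ∃ e : ℝ ≃ₘ^5⟮𝓘(ℝ, ℝ), 𝓘(ℝ, ℝ)⟯ ℝ, ∀ z : ℝ, e z = explicitG ω₁ α f φ ψ t z := by
  have hω : 0 < ω₁ := hω₁ ▸ mul_pos hω₀ hL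
  have hφ5 : ContDiff ℝ 5 φ := by
    rw [funext hφ]
    exact_mod_cast contDiff_integral_succ (n := 4) hX
  have hψ5 : ContDiff ℝ 5 ψ := by
    rw [funext hψ]
    exact contDiff_const.add (by exact_mod_cast contDiff_integral_succ (n := 4) hV)
  have hsol : IsClassicalSolution ω₁ α f φ ψ (explicitG ω₁ α f φ ψ) :=
    isClassicalSolution_explicitG hω.ne' hf (hφ5.of_le (by norm_num)) (hψ5.of_le (by norm_num))
  have hφ1 : ContDiff ℝ 1 φ := hφ5.of_le (by norm_num)
  refine ⟨⟨hsol, fun g hg t ht z => hg.unique hω hsol ht z⟩, fun t ht hpos => ?_⟩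
  have heq : (fun y => explicitG ω₁ α f φ ψ t y) = fun y => dampedWave (α / 2) ω₁ f φ ψ t y :=
    funext fun z => explicitG_eq_dampedWave hω.ne' hφ1 ht z
  have hsmooth : ContDiff ℝ 5 fun y => explicitG ω₁ α f φ ψ t y := by
    rw [heq]
    exact contDiff_dampedWave_space (n := 5) (by norm_num) hφ5 hψ5 t
  have hφL (z : ℝ) : φ (z + L) = φ z + L := by
    rw [hφ, hφ, integral_add_period hX.continuous hXper, hXint]
  have hψL (z : ℝ) : ψ (z + L) = ψ z := by
    rw [hψ, hψ, integral_add_period hV.continuous hVper, hVint, add_zero]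
  obtain ⟨d, hd, hper⟩ := exists_dampedWave_add_period (ω := ω₁) (f := f) hL
    (div_nonneg hα zero_le_two) hφ1 hψ5.continuous hφL hψL ht
  refine exists_diffeomorph_of_deriv_pos (by norm_num) hsmooth hpos ?_
  refine surjective_of_add_period (L := L) hsmooth.continuous
    (strictMono_of_deriv_pos hpos).monotone hd fun z => ?_
  rw [explicitG_eq_dampedWave hω.ne' hφ1 ht, explicitG_eq_dampedWave hω.ne' hφ1 ht, hper]
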